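/- A square group $M=(M_e\xrightarrow{H}M_{ee}\xrightarrow{P}M_e)$ consists of an additively written group $M_e$, an abelian group $M_{ee}$, a homomorphism $P$ and a map $H$ that is quadratic, i.e. whose cross-effect $(x|y)_H=H(x+y)-H(x)-H(y)$ is biadditive, such that $(Pa|y)_H=0=(x|Pb)_H$, $P(x|y)_H=-x-y+x+y$ and $PHP(a)=2P(a)$ for all $x,y\in M_e$, $a,b\in M_{ee}$. Morphisms are pairs of homomorphisms compatible with $P$ and $H$; $\mathsf{SG}$ is the category of square groups. Put $T=HP-\mathrm{Id}:M_{ee}\to M_{ee}$ and $\Delta(x)=HPH(x)+H(x+x)-4H(x)$, $\Delta:M_e\to M_{ee}$; both are homomorphisms. The tensor product $M\circledcirc N$ of square groups has $(M\circledcirc N)_{ee}=M_{ee}\otimes N_{ee}$, and $(M\circledcirc N)_e$ is the group generated by symbols $x\circledcirc y$ ($x\in M_e$, $y\in N_e$) and $a\bar\otimes b$ ($a\in M_{ee}$, $b\in N_{ee}$) subject to: $a\bar\otimes b$ is bilinear and central; $x\circledcirc(y_1+y_2)=x\circledcirc y_1+x\circledcirc y_2$; $(x_1+x_2)\circledcirc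 y=x_1\circledcirc y+x_2\circledcirc y+(x_2|x_1)_H\bar\otimes H(y)$; $x\circledcirc P(b)=(x|x)_H\bar\otimes b$; $P(a)\circledcirc y=a\bar\otimes\Delta(y)$; $T(a)\bar\otimes T(b)=-a\bar\otimes b$. Here $P(a\otimes b)=a\bar\otimes b$, and $H$ is the unique quadratic map with $H(x\circledcirc y)=(x|x)_H\otimes H(y)+H(x)\otimes\Delta(y)$, $H(a\bar\otimes b)=a\otimes b-T(a)\otimes T(b)$, whose cross-effect is given by $(x\circledcirc y\,|\,x'\circledcirc y')_H=(x|x')_H\otimes(y|y')_H$ and vanishes whenever one of its arguments is of the form $a\bar\otimes b$. A morphism $f$ induces $A\circledcirc f$ by $x\circledcirc y\mapsto x\circledcirc f(y)$, $a\bar\otimes b\mapsto a\bar\otimes f(b)$, $a\otimes b\mapsto a\otimes f(b)$. A sequence of square groups is called exact if it is exact on the $e$-level and on the $ee$-level. **Proposition.** Let $A$ be a square group. The functor $A\circledcirc-:\mathsf{SG}\to\mathsf{SG}$ preserves (small) filtered colimits, reflexive coequalizers and finite products. Moreover, for every short exact sequence of square groups $$0\to B_1\xrightarrow{\mu}B\xrightarrow{\sigma}B_2\to0$$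 the induced sequence $$A\circledcirc B_1\xrightarrow{A\circledcirc\mu}A\circledcirc B\xrightarrow{A\circledcirc\sigma}A\circledcirc B_2\to0$$ is exact, and if $A$ is a projective object of the category $\mathsf{SG}$, then $A\circledcirc\mu$ is a monomorphism. -/

import Mathlib

open CategoryTheory CategoryTheory.Limits
open scoped TensorProduct

universe u

/-- The cross-effect `(x | y)_f = f (x + y) - f x - f y`. -/
def crossEffect {G A : Type*} [AddGroup G] [AddCommGroup A] (f : G → A) (x y : G) : A :=
  f (x + y) - f x - f y

/-- A map from a group to an abelian group is quadratic if its cross-effect is biadditive. -/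
structure IsQuadraticMap {G A : Type*} [AddGroup G] [AddCommGroup A] (f : G → A) : Prop where
  add_left : ∀ x x' y, crossEffect f (x + x') y = crossEffect f x y + crossEffect f x' y
  add_right : ∀ x y y', crossEffect f x (y + y') = crossEffect f x y + crossEffect f x y'

/-- A square group: an additively written (not necessarily abelian) group `e`, an abelian
group `ee`, a homomorphism `P : ee → e` and a quadratic map `H : e → ee`. -/
structure SquareGroup : Type (u + 1) where
  e : Type u
  ee : Type u
  [addGroupE : AddGroup e]
  [addCommGroupEE : AddCommGroup ee]
  P : ee →+ e
  H : e → ee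
  quadratic : IsQuadraticMap H
  cross_P_left : ∀ a y, crossEffect H (P a) y = 0
  cross_P_right : ∀ x b, crossEffect H x (P b) = 0
  P_cross : ∀ x y, P (crossEffect H x y) = -x - y + x + y
  PHP : ∀ a, P (H (P a)) = 2 • P a

namespace SquareGroup

attribute [instance] addGroupE addCommGroupEE

/-- Morphisms of square groups: pairs of homomorphisms compatible with `P` and `H`. -/
@[ext]
structure Hom (M N : SquareGroup.{u}) where
  e : M.e →+ N.e
  ee : M.ee →+ N.ee
  comm_P : ∀ a, e (M.P a) = N.P (ee a)
  comm_H : ∀ x, ee (M.H x) = N.H (e x)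

/-- The category of square groups. -/
instance : Category SquareGroup.{u} where
  Hom := Hom
  id M := ⟨AddMonoidHom.id _, AddMonoidHom.id _, fun _ => rfl, fun _ => rfl⟩
  comp f g := ⟨g.e.comp f.e, g.ee.comp f.ee,
    fun a => by simp [f.comm_P, g.comm_P], fun x => by simp [f.comm_H, g.comm_H]⟩

@[ext]
theorem hom_ext {M N : SquareGroup.{u}} {f g : M ⟶ N} (h₁ : f.e = g.e) (h₂ : f.ee = g.ee) :
    f = g := Hom.ext h₁ h₂

@[simp] theorem id_e (M : SquareGroup.{u}) (x : M.e) : Hom.e (𝟙 M) x = x := rfl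
@[simp] theorem id_ee (M : SquareGroup.{u}) (a : M.ee) : Hom.ee (𝟙 M) a = a := rfl
@[simp] theorem comp_e {M N K : SquareGroup.{u}} (f : M ⟶ N) (g : N ⟶ K) (x : M.e) :
    Hom.e (f ≫ g) x = g.e (f.e x) := rfl
@[simp] theorem comp_ee {M N K : SquareGroup.{u}} (f : M ⟶ N) (g : N ⟶ K) (a : M.ee) :
    Hom.ee (f ≫ g) a = g.ee (f.ee a) := rfl

/-- A sequence `0 → B₁ → B → B₂ → 0` is short exact if it is exact on the `e`-level and on the
`ee`-level. -/
structure ShortExact {B₁ B B₂ : SquareGroup.{u}} (μ : B₁ ⟶ B) (σ : B ⟶ B₂) : Prop where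
  injective_e : Function.Injective μ.e
  injective_ee : Function.Injective μ.ee
  exact_e : Function.Exact μ.e σ.e
  exact_ee : Function.Exact μ.ee σ.ee
  surjective_e : Function.Surjective σ.e
  surjective_ee : Function.Surjective σ.ee

/-- A sequence `B₁ → B → B₂ → 0` is exact if it is exact on the `e`-level and on the
`ee`-level. -/
structure RightExact {B₁ B B₂ : SquareGroup.{u}} (μ : B₁ ⟶ B) (σ : B ⟶ B₂) : Prop where
  exact_e : Function.Exact μ.e σ.e
  exact_ee : Function.Exact μ.ee σ.ee
  surjective_e : Function.Surjective σ.e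
  surjective_ee : Function.Surjective σ.ee

section Basic

variable (M : SquareGroup.{u})

/-- The cross-effect `(x | y)_H`. -/
def cr (x y : M.e) : M.ee := crossEffect M.H x y

theorem cr_add_left (x x' y : M.e) : M.cr (x + x') y = M.cr x y + M.cr x' y :=
  M.quadratic.add_left x x' y
theorem cr_add_right (x y y' : M.e) : M.cr x (y + y') = M.cr x y + M.cr x y' :=
  M.quadratic.add_right x y y'
theorem cr_P_left (a : M.ee) (y : M.e) : M.cr (M.P a) y = 0 := M.cross_P_left a y
theorem cr_P_right (x : M.e) (b : M.ee) : M.cr x (M.P b) = 0 := M.cross_P_right x b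
theorem P_cr (x y : M.e) : M.P (M.cr x y) = -x - y + x + y := M.P_cross x y

theorem H_add (x y : M.e) : M.H (x + y) = M.H x + M.H y + M.cr x y := by
  unfold cr crossEffect; abel

/-- The cross-effect of `H` as a biadditive map. -/
def crHom : M.e →+ M.e →+ M.ee :=
  AddMonoidHom.mk' (fun x => AddMonoidHom.mk' (M.cr x) (M.cr_add_right x))
    (fun x x' => by ext y; exact M.cr_add_left x x' y)

@[simp] theorem crHom_apply (x y : M.e) : M.crHom x y = M.cr x y := rfl

@[simp] theorem cr_neg_right (x y : M.e) : M.cr x (-y) = -M.cr x y := map_neg (M.crHom x) y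
@[simp] theorem cr_zero_right (x : M.e) : M.cr x 0 = 0 := map_zero (M.crHom x)
@[simp] theorem cr_zero_left (x : M.e) : M.cr 0 x = 0 := by
  rw [← crHom_apply, map_zero]; rfl

theorem H_zero : M.H 0 = 0 := by
  have := M.H_add 0 0
  simpa using this

theorem H_P_add (a b : M.ee) : M.H (M.P (a + b)) = M.H (M.P a) + M.H (M.P b) := by
  rw [map_add, H_add, cr_P_left, add_zero]

/-- The involution `T = HP - Id`. -/
def T : M.ee →+ M.ee :=
  AddMonoidHom.mk' (fun a => M.H (M.P a) - a) (fun a b => by rw [H_P_add]; abel)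

theorem T_apply (a : M.ee) : M.T a = M.H (M.P a) - a := rfl

theorem P_T (a : M.ee) : M.P (M.T a) = M.P a := by
  rw [T_apply, map_sub, M.PHP, two_nsmul, add_sub_cancel_right]

theorem T_T (a : M.ee) : M.T (M.T a) = a := by
  rw [T_apply, P_T, T_apply]; abel

theorem add_eq_comm (x y : M.e) : x + y = y + x + M.P (M.cr x y) := by
  rw [P_cr]; simp [sub_eq_add_neg, add_assoc]

theorem T_cr (x y : M.e) : M.T (M.cr x y) = -M.cr y x := by
  have h := congrArg M.H (M.add_eq_comm x y)
  rw [H_add, H_add M (y + x), H_add M y x, cr_P_right] at h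
  rw [T_apply, sub_eq_iff_eq_add]
  have h' : M.H (M.P (M.cr x y)) = M.H x + M.H y + M.cr x y - (M.H y + M.H x + M.cr y x) := by
    rw [h]; abel
  rw [h']; abel

theorem delta_aux (x : M.e) :
    M.H (M.P (M.H x)) + M.H (x + x) - 4 • M.H x = M.cr x x - M.H x + M.T (M.H x) := by
  rw [H_add, T_apply]; abel

/-- The homomorphism `Δ x = HPH x + H (x + x) - 4 H x`. -/
def Δ : M.e →+ M.ee :=
  AddMonoidHom.mk' (fun x => M.H (M.P (M.H x)) + M.H (x + x) - 4 • M.H x) (fun x y => by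
    simp only [delta_aux]
    rw [H_add, cr_add_left, cr_add_right, cr_add_right, map_add, map_add, T_cr]; abel)

theorem Δ_apply (x : M.e) : M.Δ x = M.H (M.P (M.H x)) + M.H (x + x) - 4 • M.H x := rfl

theorem Δ_eq (x : M.e) : M.Δ x = M.cr x x - M.H x + M.T (M.H x) := M.delta_aux x

theorem T_Δ (x : M.e) : M.T (M.Δ x) = -M.Δ x := by
  rw [Δ_eq, map_add, map_sub, T_T, T_cr]; abel

theorem Δ_P (a : M.ee) : M.Δ (M.P a) = 0 := by
  have h : M.H (M.P a) = a + M.T a := by rw [T_apply]; abel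
  rw [Δ_eq, cr_P_left, h, map_add, T_T]; abel

theorem P_central (a : M.ee) (y : M.e) : M.P a + y = y + M.P a := by
  rw [M.add_eq_comm, cr_P_left, map_zero, add_zero]

instance normal_range : M.P.range.Normal where
  conj_mem := by
    rintro _ ⟨a, rfl⟩ g
    exact ⟨a, by rw [← M.P_central, add_neg_cancel_right]⟩

/-- The cokernel of `P`, an abelian group. -/
abbrev CokerP : Type u := M.e ⧸ M.P.range

instance : AddCommGroup M.CokerP :=
  { (inferInstance : AddGroup M.CokerP) with
    add_comm := by
      rintro ⟨x⟩ ⟨y⟩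
      exact QuotientAddGroup.eq.2 ⟨M.cr y x, by
        rw [P_cr]; simp [sub_eq_add_neg, add_assoc]⟩ }

/-- The biadditive map on the cokernel of `P` induced by the cross-effect of `H`. -/
def crCokerHom : M.CokerP →+ M.CokerP →+ M.ee :=
  QuotientAddGroup.lift M.P.range
    (AddMonoidHom.mk' (fun x => QuotientAddGroup.lift M.P.range (M.crHom x) (by
        rintro _ ⟨b, rfl⟩; exact M.cr_P_right x b))
      (fun x x' => by
        refine QuotientAddGroup.addMonoidHom_ext _ ?_
        ext y; exact M.cr_add_left x x' y))
    (by
      rintro _ ⟨a, rfl⟩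
      refine QuotientAddGroup.addMonoidHom_ext _ ?_
      ext y; exact M.cr_P_left a y)

/-- `crCokerHom` as a bilinear map over the integers. -/
def crCoker : M.CokerP →ₗ[ℤ] M.CokerP →ₗ[ℤ] M.ee :=
  LinearMap.mk₂ ℤ (fun c d => M.crCokerHom c d)
    (fun c c' d => by rw [map_add, AddMonoidHom.add_apply])
    (fun n c d => by rw [map_zsmul, AddMonoidHom.zsmul_apply])
    (fun c d d' => by rw [map_add])
    (fun n c d => by rw [map_zsmul])

/-- The class of `x` in the cokernel of `P`. -/
def toCoker : M.e →+ M.CokerP := QuotientAddGroup.mk' M.P.range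

@[simp] theorem crCoker_toCoker (x y : M.e) :
    M.crCoker (M.toCoker x) (M.toCoker y) = M.cr x y := rfl

theorem toCoker_P (a : M.ee) : M.toCoker (M.P a) = 0 :=
  (QuotientAddGroup.eq_zero_iff _).2 ⟨a, rfl⟩

end Basic

section Twist

/-- For a biadditive map `ρ : C × C → L`, the set `C × L` with the group structure
`(c, l) + (c', l') = (c + c', l + l' + ρ c c')`. A homomorphism `G → Twist ρ` is the same thing
as a homomorphism `π : G → C` with a quadratic map `G → L` whose cross-effect is
`ρ (π x) (π y)`. -/
@[ext]
structure Twist {C L : Type*} [AddCommGroup C] [AddCommGroup L] (ρ : C →ₗ[ℤ] C →ₗ[ℤ] L) where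
  base : C
  val : L

variable {C L : Type*} [AddCommGroup C] [AddCommGroup L] {ρ : C →ₗ[ℤ] C →ₗ[ℤ] L}

instance : Add (Twist ρ) := ⟨fun p q => ⟨p.base + q.base, p.val + q.val + ρ p.base q.base⟩⟩
instance : Zero (Twist ρ) := ⟨⟨0, 0⟩⟩
instance : Neg (Twist ρ) := ⟨fun p => ⟨-p.base, -p.val + ρ p.base p.base⟩⟩

@[simp] theorem Twist.add_base (p q : Twist ρ) : (p + q).base = p.base + q.base := rfl
@[simp] theorem Twist.add_val (p q : Twist ρ) :
    (p + q).val = p.val + q.val + ρ p.base q.base := rfl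
@[simp] theorem Twist.zero_base : (0 : Twist ρ).base = 0 := rfl
@[simp] theorem Twist.zero_val : (0 : Twist ρ).val = 0 := rfl
@[simp] theorem Twist.neg_base (p : Twist ρ) : (-p).base = -p.base := rfl
@[simp] theorem Twist.neg_val (p : Twist ρ) : (-p).val = -p.val + ρ p.base p.base := rfl

instance : AddGroup (Twist ρ) :=
  AddGroup.ofLeftAxioms
    (fun p q r => by ext <;> simp <;> abel)
    (fun p => by ext <;> simp)
    (fun p => by ext <;> simp)

end Twist

section Tensor

variable (M N : SquareGroup.{u})

/-- The generators of the `e`-level of the tensor product: `circ x y` stands for `x ⊛ y` and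
`bar a b` for `a ⊗̄ b`. -/
inductive TensorGen : Type u
  | circ (x : M.e) (y : N.e)
  | bar (a : M.ee) (b : N.ee)

variable {M N} in
/-- The generator `x ⊛ y` in the free group. -/
abbrev fcirc (x : M.e) (y : N.e) : FreeAddGroup (TensorGen M N) :=
  FreeAddGroup.of (TensorGen.circ x y)

variable {M N} in
/-- The generator `a ⊗̄ b` in the free group. -/
abbrev fbar (a : M.ee) (b : N.ee) : FreeAddGroup (TensorGen M N) :=
  FreeAddGroup.of (TensorGen.bar a b)

/-- The defining relations of the `e`-level of the tensor product. -/
inductive TensorRel : FreeAddGroup (TensorGen M N) → FreeAddGroup (TensorGen M N) → Prop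
  | bar_add_left (a a' : M.ee) (b : N.ee) :
      TensorRel (fbar (a + a') b) (fbar a b + fbar a' b)
  | bar_add_right (a : M.ee) (b b' : N.ee) :
      TensorRel (fbar a (b + b')) (fbar a b + fbar a b')
  | bar_central (a : M.ee) (b : N.ee) (w : FreeAddGroup (TensorGen M N)) :
      TensorRel (fbar a b + w) (w + fbar a b)
  | circ_add_right (x : M.e) (y₁ y₂ : N.e) :
      TensorRel (fcirc x (y₁ + y₂)) (fcirc x y₁ + fcirc x y₂)
  | circ_add_left (x₁ x₂ : M.e) (y : N.e) :
      TensorRel (fcirc (x₁ + x₂) y) (fcirc x₁ y + fcirc x₂ y + fbar (M.cr x₂ x₁) (N.H y))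
  | circ_P_right (x : M.e) (b : N.ee) :
      TensorRel (fcirc x (N.P b)) (fbar (M.cr x x) b)
  | circ_P_left (a : M.ee) (y : N.e) :
      TensorRel (fcirc (M.P a) y) (fbar a (N.Δ y))
  | bar_T (a : M.ee) (b : N.ee) :
      TensorRel (fbar (M.T a) (N.T b)) (-fbar a b)

/-- The `e`-level of the tensor product: the group with the generators `TensorGen` and the
relations `TensorRel`. -/
abbrev TensorE : Type u := (addConGen (TensorRel M N)).Quotient

variable {M N}

/-- The element `x ⊛ y`. -/
def circ (x : M.e) (y : N.e) : TensorE M N := ((fcirc x y : FreeAddGroup (TensorGen M N)) :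
  (addConGen (TensorRel M N)).Quotient)

/-- The element `a ⊗̄ b`. -/
def bar (a : M.ee) (b : N.ee) : TensorE M N := ((fbar a b : FreeAddGroup (TensorGen M N)) :
  (addConGen (TensorRel M N)).Quotient)

theorem TensorE.sound {v w : FreeAddGroup (TensorGen M N)} (h : TensorRel M N v w) :
    (v : (addConGen (TensorRel M N)).Quotient) = w :=
  (AddCon.eq _).2 (AddConGen.Rel.of _ _ h)

theorem bar_add_left (a a' : M.ee) (b : N.ee) : bar (a + a') b = bar a b + bar a' b :=
  TensorE.sound (.bar_add_left a a' b)
theorem bar_add_right (a : M.ee) (b b' : N.ee) : bar a (b + b') = bar a b + bar a b' :=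
  TensorE.sound (.bar_add_right a b b')
theorem bar_central (a : M.ee) (b : N.ee) (w : TensorE M N) : bar a b + w = w + bar a b := by
  induction w using AddCon.induction_on with
  | H w => exact TensorE.sound (.bar_central a b w)
theorem circ_add_right (x : M.e) (y₁ y₂ : N.e) : circ x (y₁ + y₂) = circ x y₁ + circ x y₂ :=
  TensorE.sound (.circ_add_right x y₁ y₂)
theorem circ_add_left (x₁ x₂ : M.e) (y : N.e) :
    circ (x₁ + x₂) y = circ x₁ y + circ x₂ y + bar (M.cr x₂ x₁) (N.H y) :=
  TensorE.sound (.circ_add_left x₁ x₂ y)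
theorem circ_P_right (x : M.e) (b : N.ee) : circ x (N.P b) = bar (M.cr x x) b :=
  TensorE.sound (.circ_P_right x b)
theorem circ_P_left (a : M.ee) (y : N.e) : circ (M.P a) y = bar a (N.Δ y) :=
  TensorE.sound (.circ_P_left a y)
theorem bar_T (a : M.ee) (b : N.ee) : bar (M.T a) (N.T b) = -bar a b :=
  TensorE.sound (.bar_T a b)

@[elab_as_elim]
theorem TensorE.induction {p : TensorE M N → Prop} (zero : p 0)
    (circ : ∀ x y, p (circ x y)) (bar : ∀ a b, p (bar a b))
    (neg : ∀ u, p u → p (-u)) (add : ∀ u v, p u → p v → p (u + v)) (u : TensorE M N) : p u := by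
  induction u using AddCon.induction_on with
  | H w =>
    induction w using FreeAddGroup.induction_on with
    | C1 => exact zero
    | of g => cases g with
      | circ x y => exact circ x y
      | bar a b => exact bar a b
    | neg_of g h => exact neg _ h
    | add v w hv hw => exact add _ _ hv hw

/-- The universal property of the presented group `TensorE M N`. -/
def TensorE.lift {G : Type*} [AddGroup G] (c : M.e → N.e → G) (b : M.ee → N.ee → G)
    (h : ∀ v w, TensorRel M N v w →
      FreeAddGroup.lift (fun g => TensorGen.casesOn g c b) v
        = (FreeAddGroup.lift (fun g => TensorGen.casesOn g c b) w : G)) :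
    TensorE M N →+ G :=
  AddCon.lift _ (FreeAddGroup.lift (fun g => TensorGen.casesOn g c b))
    (AddCon.addConGen_le.2 fun v w r => (AddCon.ker_rel _).2 (h v w r))

@[simp] theorem TensorE.lift_circ {G : Type*} [AddGroup G] (c : M.e → N.e → G)
    (b : M.ee → N.ee → G) (h) (x : M.e) (y : N.e) : TensorE.lift c b h (circ x y) = c x y := by
  unfold TensorE.lift SquareGroup.circ
  rw [AddCon.lift_coe, FreeAddGroup.lift_apply_of]

@[simp] theorem TensorE.lift_bar {G : Type*} [AddGroup G] (c : M.e → N.e → G)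
    (b : M.ee → N.ee → G) (h) (x : M.ee) (y : N.ee) : TensorE.lift c b h (bar x y) = b x y := by
  unfold TensorE.lift SquareGroup.bar
  rw [AddCon.lift_coe, FreeAddGroup.lift_apply_of]

variable (M N)

/-- The center of a group is abelian. -/
abbrev centerAddCommGroup (G : Type*) [AddGroup G] : AddCommGroup (AddSubgroup.center G) :=
  { (inferInstance : AddGroup (AddSubgroup.center G)) with
    add_comm := fun a b => Subtype.ext (AddSubgroup.mem_center_iff.1 b.2 a) }

attribute [local instance] centerAddCommGroup

/-- The homomorphism `P (a ⊗ b) = a ⊗̄ b`, with values in the center. -/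
def tensorPCenter : M.ee ⊗[ℤ] N.ee →+ AddSubgroup.center (TensorE M N) :=
  TensorProduct.liftAddHom
    (AddMonoidHom.mk' (fun a => AddMonoidHom.mk'
        (fun b => (⟨bar a b, AddSubgroup.mem_center_iff.2 fun w => (bar_central a b w).symm⟩ :
          AddSubgroup.center (TensorE M N)))
        (fun b b' => Subtype.ext (bar_add_right a b b')))
      (fun a a' => by ext b; exact bar_add_left a a' b))
    (fun n a b => by rw [map_zsmul, AddMonoidHom.smul_apply, map_zsmul])

/-- The homomorphism `P (a ⊗ b) = a ⊗̄ b`. -/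
def tensorP : M.ee ⊗[ℤ] N.ee →+ TensorE M N :=
  (AddSubgroup.center (TensorE M N)).subtype.comp (tensorPCenter M N)

@[simp] theorem tensorP_tmul (a : M.ee) (b : N.ee) : tensorP M N (a ⊗ₜ b) = bar a b := rfl

theorem tensorP_central (t : M.ee ⊗[ℤ] N.ee) (w : TensorE M N) :
    tensorP M N t + w = w + tensorP M N t :=
  (AddSubgroup.mem_center_iff.1 (tensorPCenter M N t).2 w).symm

/-- The bilinear map `ρ (a ⊗ b) (a' ⊗ b') = (a | a')_H ⊗ (b | b')_H`. -/
def rho : M.CokerP ⊗[ℤ] N.CokerP →ₗ[ℤ] M.CokerP ⊗[ℤ] N.CokerP →ₗ[ℤ] M.ee ⊗[ℤ] N.ee :=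
  TensorProduct.map₂ M.crCoker N.crCoker

@[simp] theorem rho_tmul (x x' : M.e) (y y' : N.e) :
    rho M N (M.toCoker x ⊗ₜ N.toCoker y) (M.toCoker x' ⊗ₜ N.toCoker y')
      = M.cr x x' ⊗ₜ N.cr y y' := by
  rfl

@[simp] theorem bar_zero_left (b : N.ee) : bar (0 : M.ee) b = (0 : TensorE M N) := by
  rw [← tensorP_tmul, TensorProduct.zero_tmul, map_zero]

@[simp] theorem bar_zero_right (a : M.ee) : bar a (0 : N.ee) = (0 : TensorE M N) := by
  rw [← tensorP_tmul, TensorProduct.tmul_zero, map_zero]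

/-- The value of `H` on `x ⊛ y`. -/
def hcirc (x : M.e) (y : N.e) : M.ee ⊗[ℤ] N.ee := M.cr x x ⊗ₜ N.H y + M.H x ⊗ₜ N.Δ y

/-- The value of `H` on `a ⊗̄ b`. -/
def hbar (a : M.ee) (b : N.ee) : M.ee ⊗[ℤ] N.ee := a ⊗ₜ b - M.T a ⊗ₜ N.T b

/-- The homomorphism from `(M ⊛ N)_e` to `Twist ρ` whose components are the projection to
`Coker P ⊗ Coker P` and the quadratic map `H`. -/
def tensorTwist : TensorE M N →+ Twist (rho M N) :=
  TensorE.lift (fun x y => ⟨M.toCoker x ⊗ₜ N.toCoker y, hcirc M N x y⟩)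
    (fun a b => ⟨0, hbar M N a b⟩) (by
      intro v w r
      cases r with
      | bar_add_left a a' b =>
        ext
        · simp
        · simp [hcirc, hbar, TensorProduct.add_tmul]; abel
      | bar_add_right a b b' =>
        ext
        · simp
        · simp [hcirc, hbar, TensorProduct.tmul_add]; abel
      | bar_central a b w =>
        ext
        · simp
        · simp [add_comm]
      | circ_add_right x y₁ y₂ =>
        ext
        · simp [hcirc, hbar, TensorProduct.tmul_add]
        · simp [hcirc, hbar, TensorProduct.tmul_add, H_add]; abel
      | circ_add_left x₁ x₂ y =>
        ext
        · simp [hcirc, hbar, TensorProduct.add_tmul]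
        · have h : N.cr y y = N.Δ y + N.H y - N.T (N.H y) := by rw [Δ_eq]; abel
          simp [hcirc, hbar, TensorProduct.add_tmul, TensorProduct.tmul_add, TensorProduct.tmul_sub,
            TensorProduct.neg_tmul, H_add, cr_add_left, cr_add_right, T_cr, h]; abel
      | circ_P_right x b =>
        ext
        · simp [toCoker_P]
        · have h : N.H (N.P b) = b + N.T b := by rw [T_apply]; abel
          simp [hcirc, hbar, Δ_P, h, T_cr, TensorProduct.tmul_add, TensorProduct.neg_tmul]
      | circ_P_left a y =>
        ext
        · simp [toCoker_P]
        · have h : M.H (M.P a) = a + M.T a := by rw [T_apply]; abel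
          simp [hcirc, hbar, cr_P_left, h, T_Δ, TensorProduct.add_tmul, TensorProduct.tmul_neg]
      | bar_T a b =>
        ext
        · simp
        · simp [hbar, T_T])

/-- The projection of `(M ⊛ N)_e` to `Coker P ⊗ Coker P`. -/
def tensorπ (u : TensorE M N) : M.CokerP ⊗[ℤ] N.CokerP := (tensorTwist M N u).base

/-- The quadratic map `H` of the tensor product. -/
def tensorH (u : TensorE M N) : M.ee ⊗[ℤ] N.ee := (tensorTwist M N u).val

theorem tensorπ_add (u v : TensorE M N) :
    tensorπ M N (u + v) = tensorπ M N u + tensorπ M N v := by simp [tensorπ]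
theorem tensorπ_neg (u : TensorE M N) : tensorπ M N (-u) = -tensorπ M N u := by simp [tensorπ]
@[simp] theorem tensorπ_zero : tensorπ M N 0 = 0 := by simp [tensorπ]
@[simp] theorem tensorπ_circ (x : M.e) (y : N.e) :
    tensorπ M N (circ x y) = M.toCoker x ⊗ₜ N.toCoker y := by simp [tensorπ, tensorTwist]
@[simp] theorem tensorπ_bar (a : M.ee) (b : N.ee) : tensorπ M N (bar a b) = 0 := by
  simp [tensorπ, tensorTwist]
theorem tensorπ_P (t : M.ee ⊗[ℤ] N.ee) : tensorπ M N (tensorP M N t) = 0 := by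
  induction t using TensorProduct.induction_on with
  | zero => simp
  | tmul a b => simp
  | add s t hs ht => rw [map_add, tensorπ_add, hs, ht, add_zero]

theorem tensorH_add (u v : TensorE M N) : tensorH M N (u + v)
    = tensorH M N u + tensorH M N v + rho M N (tensorπ M N u) (tensorπ M N v) := by
  simp [tensorH, tensorπ]
@[simp] theorem tensorH_circ (x : M.e) (y : N.e) :
    tensorH M N (circ x y) = M.cr x x ⊗ₜ N.H y + M.H x ⊗ₜ N.Δ y := by
  simp [tensorH, tensorTwist, hcirc]
@[simp] theorem tensorH_bar (a : M.ee) (b : N.ee) :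
    tensorH M N (bar a b) = a ⊗ₜ b - M.T a ⊗ₜ N.T b := by
  simp [tensorH, tensorTwist, hbar]
@[simp] theorem tensorH_zero : tensorH M N 0 = 0 := by simp [tensorH]

/-- The cross-effect of `H` is `ρ`. -/
theorem crossEffect_tensorH (u v : TensorE M N) :
    crossEffect (tensorH M N) u v = rho M N (tensorπ M N u) (tensorπ M N v) := by
  rw [crossEffect, tensorH_add]; abel

theorem circ_zero_right (x : M.e) : circ x (0 : N.e) = (0 : TensorE M N) := by
  have h := circ_add_right x (0 : N.e) 0
  rw [add_zero] at h
  exact left_eq_add.1 h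

theorem circ_zero_left (y : N.e) : circ (0 : M.e) y = (0 : TensorE M N) := by
  have h := circ_P_left (0 : M.ee) y
  rwa [map_zero, bar_zero_left] at h

theorem circ_comm (x x' : M.e) (y y' : N.e) : circ x y + circ x' y'
    = circ x' y' + circ x y + bar (M.cr x x') (N.cr y y') := by
  have h₁ := circ_add_right (x' + x) y y'
  have h₂ := circ_add_left x' x (y + y')
  rw [circ_add_left x' x y, circ_add_left x' x y'] at h₁
  rw [h₁, circ_add_right x', circ_add_right x, H_add, bar_add_right, bar_add_right] at h₂
  set p := circ x y
  set q := circ x' y'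
  set r := circ x' y
  set s := circ x y'
  set k := bar (M.cr x x') (N.H y) with hk
  set k' := bar (M.cr x x') (N.H y') with hk'
  set l := bar (M.cr x x') (N.cr y y') with hl
  have e₁ : r + p + k + (q + s + k') = r + ((p + q) + (s + (k + k'))) := by
    have c : k + (q + s + k') = q + s + k' + k := bar_central _ _ _
    have c' : k' + k = k + k' := bar_central _ _ _
    rw [add_assoc (r + p), c, add_assoc (q + s), c']
    simp only [add_assoc]
  have e₂ : r + q + (p + s) + (k + k' + l) = r + ((q + p + l) + (s + (k + k'))) := by
    have c : l + (s + (k + k')) = s + (k + k') + l := bar_central _ _ _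
    rw [add_assoc (q + p), c]
    simp only [add_assoc]
  rw [e₁, e₂] at h₂
  exact add_right_cancel (add_left_cancel h₂)

theorem tensor_comm (u v : TensorE M N) : u + v
    = v + u + tensorP M N (rho M N (tensorπ M N u) (tensorπ M N v)) := by
  induction u using TensorE.induction with
  | zero => simp
  | bar a b => simp [bar_central]
  | neg u h =>
    have c := fun t w => tensorP_central M N t w
    rw [tensorπ_neg, map_neg, LinearMap.neg_apply, map_neg]
    set t := rho M N (tensorπ M N u) (tensorπ M N v)
    apply add_left_cancel (a := u)
    rw [add_neg_cancel_left, ← add_assoc, ← add_assoc, h, add_assoc (v + u), c]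
    simp [add_assoc]
  | add u u' h h' =>
    have c := fun t w => tensorP_central M N t w
    rw [tensorπ_add, map_add, LinearMap.add_apply, map_add]
    rw [add_assoc, h', ← add_assoc, ← add_assoc, h]
    rw [add_assoc (v + u), c]
    simp [add_assoc]
  | circ x y =>
    induction v using TensorE.induction with
    | zero => simp
    | bar a b => simp [bar_central]
    | circ x' y' => simpa using circ_comm M N x x' y y'
    | neg v h =>
      have c := fun t w => tensorP_central M N t w
      rw [tensorπ_neg, map_neg, map_neg]
      set t := rho M N (tensorπ M N (circ x y)) (tensorπ M N v)
      apply add_left_cancel (a := v)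
      rw [← add_assoc, ← add_assoc, ← add_assoc, add_neg_cancel, zero_add]
      have h' : v + circ x y = circ x y + v - tensorP M N t := by rw [h]; simp
      rw [h', sub_eq_add_neg, ← map_neg, add_assoc _ v, ← c]
      simp only [add_assoc]
      rw [c]
      simp
    | add v v' h h' =>
      have c := fun t w => tensorP_central M N t w
      rw [tensorπ_add, map_add, map_add]
      rw [← add_assoc, h, add_assoc _ _ v', c, ← add_assoc, add_assoc v, h']
      rw [c (rho M N _ (tensorπ M N v))]
      simp only [add_assoc]

theorem tensorH_P_add (s t : M.ee ⊗[ℤ] N.ee) : tensorH M N (tensorP M N (s + t))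
    = tensorH M N (tensorP M N s) + tensorH M N (tensorP M N t) := by
  rw [map_add, tensorH_add, tensorπ_P, map_zero, LinearMap.zero_apply, add_zero]

/-- The tensor product `M ⊛ N` of square groups. -/
def tensor : SquareGroup.{u} where
  e := TensorE M N
  ee := M.ee ⊗[ℤ] N.ee
  P := tensorP M N
  H := tensorH M N
  quadratic :=
    ⟨fun u u' v => by simp [crossEffect_tensorH, tensorπ_add],
      fun u v v' => by simp [crossEffect_tensorH, tensorπ_add]⟩
  cross_P_left t v := by simp [crossEffect_tensorH, tensorπ_P]
  cross_P_right u t := by simp [crossEffect_tensorH, tensorπ_P]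
  P_cross u v := by
    rw [crossEffect_tensorH, add_assoc, tensor_comm M N u v]
    simp [sub_eq_add_neg, add_assoc]
  PHP t := by
    induction t using TensorProduct.induction_on with
    | zero => simp
    | tmul a b => simp [bar_T, two_nsmul]
    | add s t hs ht => rw [tensorH_P_add, map_add, hs, ht, ← map_nsmul, ← map_nsmul, ← map_nsmul, nsmul_add, map_add]

end Tensor

section Functor

variable (A : SquareGroup.{u}) {B C : SquareGroup.{u}} (f : B ⟶ C)

theorem Hom.map_cr (x y : B.e) : f.ee (B.cr x y) = C.cr (f.e x) (f.e y) := by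
  simp [cr, crossEffect, f.comm_H]

theorem Hom.map_T (a : B.ee) : f.ee (B.T a) = C.T (f.ee a) := by
  simp [T_apply, f.comm_H, f.comm_P]

theorem Hom.map_Δ (x : B.e) : f.ee (B.Δ x) = C.Δ (f.e x) := by
  simp [Δ_apply, f.comm_H, f.comm_P]

/-- The homomorphism `x ⊛ y ↦ x ⊛ f y`, `a ⊗̄ b ↦ a ⊗̄ f b`. -/
def tensorMapE : TensorE A B →+ TensorE A C :=
  TensorE.lift (fun x y => circ x (f.e y)) (fun a b => bar a (f.ee b)) (by
    intro v w r
    cases r with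
    | bar_add_left a a' b => simp [bar_add_left]
    | bar_add_right a b b' => simp [bar_add_right]
    | bar_central a b w => simp [bar_central]
    | circ_add_right x y₁ y₂ => simp [circ_add_right]
    | circ_add_left x₁ x₂ y => simp [circ_add_left, f.comm_H]
    | circ_P_right x b => simp [circ_P_right, f.comm_P]
    | circ_P_left a y => simp [circ_P_left, f.map_Δ]
    | bar_T a b => simp [bar_T, f.map_T])

@[simp] theorem tensorMapE_circ (x : A.e) (y : B.e) :
    tensorMapE A f (circ x y) = circ x (f.e y) := by simp [tensorMapE]
@[simp] theorem tensorMapE_bar (a : A.ee) (b : B.ee) :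
    tensorMapE A f (bar a b) = bar a (f.ee b) := by simp [tensorMapE]

/-- The homomorphism `a ⊗ b ↦ a ⊗ f b`. -/
def tensorMapEE : A.ee ⊗[ℤ] B.ee →+ A.ee ⊗[ℤ] C.ee :=
  (LinearMap.lTensor A.ee f.ee.toIntLinearMap).toAddMonoidHom

@[simp] theorem tensorMapEE_tmul (a : A.ee) (b : B.ee) :
    tensorMapEE A f (a ⊗ₜ b) = a ⊗ₜ f.ee b := rfl

theorem TensorE.hom_ext {M N : SquareGroup.{u}} {G : Type*} [AddGroup G] {g h : TensorE M N →+ G}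
    (h₁ : ∀ x y, g (circ x y) = h (circ x y)) (h₂ : ∀ a b, g (bar a b) = h (bar a b)) :
    g = h := by
  refine DFunLike.ext _ _ fun u => ?_
  induction u using TensorE.induction with
  | zero => simp
  | circ x y => exact h₁ x y
  | bar a b => exact h₂ a b
  | neg u hu => simp [hu]
  | add u v hu hv => simp [hu, hv]

theorem tensorMap_rho (u v : TensorE A B) :
    tensorMapEE A f (rho A B (tensorπ A B u) (tensorπ A B v))
      = rho A C (tensorπ A C (tensorMapE A f u)) (tensorπ A C (tensorMapE A f v)) := by
  induction u using TensorE.induction with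
  | zero => simp
  | bar a b => simp
  | neg u h => simp [tensorπ_neg, h]
  | add u u' h h' => simp [tensorπ_add, h, h']
  | circ x y =>
    induction v using TensorE.induction with
    | zero => simp
    | bar a b => simp
    | neg v h => simp only [tensorπ_neg, map_neg, h]
    | add v v' h h' => simp only [tensorπ_add, map_add, h, h']
    | circ x' y' => simp [f.map_cr]

theorem tensorH_neg (M N : SquareGroup.{u}) (u : TensorE M N) : tensorH M N (-u)
    = -tensorH M N u + rho M N (tensorπ M N u) (tensorπ M N u) := by
  simp [tensorH, tensorπ]

/-- The morphism `A ⊛ f : A ⊛ B ⟶ A ⊛ C`. -/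
def tensorMap : tensor A B ⟶ tensor A C where
  e := tensorMapE A f
  ee := tensorMapEE A f
  comm_P t := by
    change tensorMapE A f (tensorP A B t) = tensorP A C (tensorMapEE A f t)
    induction t using TensorProduct.induction_on with
    | zero => simp
    | tmul a b => simp
    | add s t hs ht => simp only [map_add, hs, ht]
  comm_H u := by
    change tensorMapEE A f (tensorH A B u) = tensorH A C (tensorMapE A f u)
    induction u using TensorE.induction with
    | zero => simp
    | circ x y => simp [f.comm_H, f.map_Δ]
    | bar a b => simp [f.map_T]
    | neg u h => rw [tensorH_neg, map_add, map_neg, h, tensorMap_rho, map_neg, tensorH_neg]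
    | add u v hu hv => rw [tensorH_add, map_add, map_add, hu, hv, tensorMap_rho, map_add,
        tensorH_add]

/-- The functor `A ⊛ -` on the category of square groups. -/
def tensorLeft : SquareGroup.{u} ⥤ SquareGroup.{u} where
  obj B := tensor A B
  map f := tensorMap A f
  map_id B := by
    apply hom_ext
    · exact TensorE.hom_ext (fun x y => tensorMapE_circ A _ x y) (fun a b => tensorMapE_bar A _ a b)
    · ext t
      change tensorMapEE A (𝟙 B) t = t
      induction t using TensorProduct.induction_on with
      | zero => simp
      | tmul a b => simp
      | add s t hs ht => rw [map_add, hs, ht]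
  map_comp {B C D} f g := by
    apply hom_ext
    · refine TensorE.hom_ext (fun x y => ?_) (fun a b => ?_)
      · change tensorMapE A (f ≫ g) (circ x y) = tensorMapE A g (tensorMapE A f (circ x y))
        simp
      · change tensorMapE A (f ≫ g) (bar a b) = tensorMapE A g (tensorMapE A f (bar a b))
        simp
    · ext t
      change tensorMapEE A (f ≫ g) t = tensorMapEE A g (tensorMapEE A f t)
      induction t using TensorProduct.induction_on with
      | zero => simp
      | tmul a b => simp
      | add s t hs ht => simp only [map_add, hs, ht]

end Functor

end SquareGroup

/-! The group `(A ⊛ B)_e` is presented by generators and relations, and each relation involves at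
most two elements of `B`; for the centrality of `a ⊗̄ b` this is so because commuting with
generators suffices. Hence homomorphisms out of `(A ⊛ Q)_e` can be built along any directed, jointly
surjective family of morphisms into `Q` (`exists_tensorE_desc`). For a filtered diagram, whose
colimit is computed levelwise, this gives preservation of filtered colimits. For a single surjection
`q` it bounds the kernel of `A ⊛ q` by any normal subgroup containing the generators with second
entry in the kernel of `q` (`ker_tensorMapE_le`).

Right exactness then reduces to normality of the image of `A ⊛ μ`, which holds because commutators
in a tensor product are values of `P` on cross-effects. The coequalizer of a reflexive pair is the
quotient by `f (ker g)`, and this description survives tensoring. For products, elements coming from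
different factors have zero cross-effect, so the two inclusions have commuting images and `A ⊛ (B ×
B')` splits.

For the last claim, a projective `A` is a retract of a free square group (`cover`), so it is enough
to treat free ones. The `ee`-level is flat. On the `e`-level, `Coker P` of a free square group is
free abelian on a set `X`, and each `i : X` gives a natural homomorphism `coord i : (A ⊛ B)_e →
B_e`. The coordinates and `H` jointly detect zero. If all coordinates of `u` vanish, then `u = P t`
(`tensorπ_eq_zero`, `exists_tensorP_eq`). If also `H u = 0`, then `t` is invariant under `T ⊗ T`,
since `H P = 1 - T ⊗ T`. Now `A_ee` consists of the diagonal elements `(i | i)` and two halves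
exchanged by `T`. The halves cancel under `P` because `T a ⊗̄ T b = -a ⊗̄ b`, and the diagonal part
is governed by the coordinates because `(x | x) ⊗̄ b = x ⊛ P b` (`tensorP_eq_zero`). Both invariants
are natural in `B`, and a levelwise injection reflects their vanishing. -/

namespace SquareGroup

/-! ### Descent for homomorphisms out of the presented group. -/

section Descent

variable {A Q : SquareGroup.{u}}

/-- Homomorphisms out of `(A ⊛ Q)_e` can be defined along a directed jointly surjective family
`C j ⟶ Q`. -/
theorem exists_tensorE_desc {J : Type*} (C : J → SquareGroup.{u}) (q : ∀ j, C j ⟶ Q)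
    (dir : ∀ j k, ∃ l, ∃ (f : C j ⟶ C l) (g : C k ⟶ C l), f ≫ q l = q j ∧ g ≫ q l = q k)
    (surj_e : ∀ y, ∃ j y', (q j).e y' = y) (surj_ee : ∀ b, ∃ j b', (q j).ee b' = b)
    {G : Type*} [AddGroup G] (h : ∀ j, TensorE A (C j) →+ G)
    (hc : ∀ j k x y y', (q j).e y = (q k).e y' → h j (circ x y) = h k (circ x y'))
    (hb : ∀ j k a b b', (q j).ee b = (q k).ee b' → h j (bar a b) = h k (bar a b')) :
    ∃ g : TensorE A Q →+ G, ∀ j, g.comp (tensorMapE A (q j)) = h j := by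
  choose je se hse using surj_e
  choose jee see hsee using surj_ee
  obtain ⟨c, ec⟩ : ∃ c : A.e → Q.e → G, ∀ j x y, c x ((q j).e y) = h j (circ x y) :=
    ⟨fun x y => h (je y) (circ x (se y)), fun j x y => hc _ _ _ _ _ (hse _)⟩
  obtain ⟨d, ed⟩ : ∃ d : A.ee → Q.ee → G, ∀ j a b, d a ((q j).ee b) = h j (bar a b) :=
    ⟨fun a b => h (jee b) (bar a (see b)), fun j a b => hb _ _ _ _ _ (hsee _)⟩
  -- Directedness brings any two elements of `Q`, on the same or on different levels, to one stage;
  -- there the defining relations already hold in `TensorE A (C j)`.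
  have pair_e : ∀ y y', ∃ j z z', (q j).e z = y ∧ (q j).e z' = y' := fun y y' => by
    obtain ⟨l, f, g, hf, hg⟩ := dir (je y) (je y')
    refine ⟨l, f.e (se y), g.e (se y'), ?_, ?_⟩
    · rw [← comp_e, hf, hse]
    · rw [← comp_e, hg, hse]
  have pair_ee : ∀ y y', ∃ j z z', (q j).ee z = y ∧ (q j).ee z' = y' := fun y y' => by
    obtain ⟨l, f, g, hf, hg⟩ := dir (jee y) (jee y')
    refine ⟨l, f.ee (see y), g.ee (see y'), ?_, ?_⟩
    · rw [← comp_ee, hf, hsee]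
    · rw [← comp_ee, hg, hsee]
  have pair_m : ∀ y y', ∃ j z z', (q j).ee z = y ∧ (q j).e z' = y' := fun y y' => by
    obtain ⟨l, f, g, hf, hg⟩ := dir (jee y) (je y')
    refine ⟨l, f.ee (see y), g.e (se y'), ?_, ?_⟩
    · rw [← comp_ee, hf, hsee]
    · rw [← comp_e, hg, hse]
  refine ⟨TensorE.lift c d ?_, fun j => ?_⟩
  · intro v w r
    cases r with
    | bar_add_left a a' b =>
      obtain ⟨j, z, -, rfl, -⟩ := pair_ee b b
      simp [ed, bar_add_left]
    | bar_add_right a b b' =>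
      obtain ⟨j, z, z', rfl, rfl⟩ := pair_ee b b'
      simp only [map_add, FreeAddGroup.lift_apply_of]
      rw [← map_add, ed, ed, ed, bar_add_right, map_add]
    | bar_central a b w =>
      simp only [map_add]
      -- The word `w` may involve many stages, but the elements commuting with a fixed one form a
      -- subgroup, so a single generator at a time suffices.
      induction w using FreeAddGroup.induction_on with
      | C1 => simp
      | of g =>
        cases g with
        | circ x y =>
          obtain ⟨j, z, z', rfl, rfl⟩ := pair_m b y
          simp [ec, ed, ← map_add, bar_central]
        | bar a' b' =>
          obtain ⟨j, z, z', rfl, rfl⟩ := pair_ee b b'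
          simp [ed, ← map_add, bar_central a z (bar a' z')]
      | neg_of g hg => rw [map_neg]; exact AddCommute.neg_right hg
      | add v w hv hw => rw [map_add]; exact AddCommute.add_right hv hw
    | circ_add_right x y y' =>
      obtain ⟨j, z, z', rfl, rfl⟩ := pair_e y y'
      simp only [map_add, FreeAddGroup.lift_apply_of]
      rw [← map_add, ec, ec, ec, circ_add_right, map_add]
    | circ_add_left x₁ x₂ y =>
      obtain ⟨j, z, -, rfl, -⟩ := pair_e y y
      simp [ec, ed, circ_add_left, ← (q j).comm_H]
    | circ_P_right x b =>
      obtain ⟨j, z, -, rfl, -⟩ := pair_ee b b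
      simp [ec, ed, ← (q j).comm_P, circ_P_right]
    | circ_P_left a y =>
      obtain ⟨j, z, -, rfl, -⟩ := pair_e y y
      simp [ec, ed, ← (q j).map_Δ, circ_P_left]
    | bar_T a b =>
      obtain ⟨j, z, -, rfl, -⟩ := pair_ee b b
      simp [ed, ← (q j).map_T, bar_T]
  · exact TensorE.hom_ext (fun x y => by simp [ec]) (fun a b => by simp [ed])

end Descent

/-! ### Kernels of `A ⊛ q` for surjective `q`. -/

section Quotient

variable {A C Q : SquareGroup.{u}} (q : C ⟶ Q)

theorem circ_neg_right (x : A.e) (y : C.e) : circ x (-y) = (-circ x y : TensorE A C) := by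
  rw [eq_neg_iff_add_eq_zero, ← circ_add_right, neg_add_cancel, circ_zero_right]

theorem bar_neg_right (a : A.ee) (b : C.ee) : bar a (-b) = (-bar a b : TensorE A C) := by
  rw [eq_neg_iff_add_eq_zero, ← bar_add_right, neg_add_cancel, bar_zero_right]

/-- The kernel of `(A ⊛ q)_e` is generated as a normal subgroup by the generators whose second
entry is in the kernel of `q`. -/
theorem ker_tensorMapE_le (he : Function.Surjective q.e) (hee : Function.Surjective q.ee)
    (R : AddSubgroup (TensorE A C)) [R.Normal] (hR : ∀ x y, q.e y = 0 → circ x y ∈ R)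
    (hR' : ∀ a b, q.ee b = 0 → bar a b ∈ R) : (tensorMapE A q).ker ≤ R := by
  -- Descent along the one-member family `q` factors the projection modulo `R` through `A ⊛ q`.
  -- Compatibility holds because generators are additive in the second entry, so two of them with
  -- equal image differ by a generator in `R`.
  obtain ⟨g, hg⟩ := exists_tensorE_desc (A := A) (J := Unit) (fun _ => C) (fun _ => q)
    (fun _ _ => ⟨(), 𝟙 _, 𝟙 _, by simp, by simp⟩)
    (fun y => ⟨(), he y⟩) (fun b => ⟨(), hee b⟩) (fun _ => QuotientAddGroup.mk' R)
    (fun _ _ x y y' h => by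
      refine QuotientAddGroup.eq.2 ?_
      rw [← circ_neg_right, ← circ_add_right]
      exact hR _ _ (by rw [map_add, map_neg, h, neg_add_cancel]))
    (fun _ _ x y y' h => by
      refine QuotientAddGroup.eq.2 ?_
      rw [← bar_neg_right, ← bar_add_right]
      exact hR' _ _ (by rw [map_add, map_neg, h, neg_add_cancel]))
  intro u hu
  have h := DFunLike.congr_fun (hg ()) u
  rw [AddMonoidHom.comp_apply, (AddMonoidHom.mem_ker.1 hu), map_zero] at h
  exact (QuotientAddGroup.eq_zero_iff u).1 h.symm

theorem tensorMapE_surjective (he : Function.Surjective q.e) (hee : Function.Surjective q.ee) :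
    Function.Surjective (tensorMapE A q) := by
  intro u
  induction u using TensorE.induction with
  | zero => exact ⟨0, map_zero _⟩
  | circ x y => obtain ⟨y, rfl⟩ := he y; exact ⟨circ x y, by simp⟩
  | bar a b => obtain ⟨b, rfl⟩ := hee b; exact ⟨bar a b, by simp⟩
  | neg u hu => obtain ⟨v, rfl⟩ := hu; exact ⟨-v, map_neg _ _⟩
  | add u v hu hv =>
    obtain ⟨u, rfl⟩ := hu
    obtain ⟨v, rfl⟩ := hv
    exact ⟨u + v, map_add _ _ _⟩

theorem tensorMapEE_surjective (hee : Function.Surjective q.ee) :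
    Function.Surjective (tensorMapEE A q) :=
  LinearMap.lTensor_surjective A.ee (g := q.ee.toIntLinearMap) hee

/-- The kernel of `(A ⊛ q)_ee` is generated by the elementary tensors whose second entry is in
the kernel of `q`. -/
theorem ker_tensorMapEE_le (hee : Function.Surjective q.ee)
    (R : AddSubgroup (A.ee ⊗[ℤ] C.ee)) (hR : ∀ a b, q.ee b = 0 → a ⊗ₜ b ∈ R) :
    (tensorMapEE A q).ker ≤ R := by
  intro u hu
  have hx := lTensor_exact A.ee (f := q.ee.toIntLinearMap.ker.subtype) (g := q.ee.toIntLinearMap)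
    (LinearMap.exact_subtype_ker_map _) hee
  obtain ⟨v, rfl⟩ := (hx u).1 hu
  induction v using TensorProduct.induction_on with
  | zero => rw [map_zero]; exact R.zero_mem
  | tmul a b => exact hR a b b.2
  | add v w hv hw =>
    rw [map_add] at hu ⊢
    refine R.add_mem (hv ?_) (hw ?_)
    · exact (hx _).2 ⟨_, rfl⟩
    · exact (hx _).2 ⟨_, rfl⟩

end Quotient

/-! ### Right exactness. -/

section RightExact

variable (A : SquareGroup.{u}) {B₁ B B₂ : SquareGroup.{u}}

theorem tensorMapE_comp {B C D : SquareGroup.{u}} (f : B ⟶ C) (g : C ⟶ D) (u : TensorE A B) :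
    tensorMapE A (f ≫ g) u = tensorMapE A g (tensorMapE A f u) :=
  DFunLike.congr_fun (TensorE.hom_ext (g := tensorMapE A (f ≫ g))
    (h := (tensorMapE A g).comp (tensorMapE A f)) (by simp) (by simp)) u

theorem tensorMapEE_comp {B C D : SquareGroup.{u}} (f : B ⟶ C) (g : C ⟶ D)
    (t : A.ee ⊗[ℤ] B.ee) :
    tensorMapEE A (f ≫ g) t = tensorMapEE A g (tensorMapEE A f t) := by
  induction t using TensorProduct.induction_on with
  | zero => simp
  | tmul a b => simp
  | add s t hs ht => simp only [map_add, hs, ht]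

theorem tensorMapE_tensorP {B C : SquareGroup.{u}} (f : B ⟶ C) (t : A.ee ⊗[ℤ] B.ee) :
    tensorMapE A f (tensorP A B t) = tensorP A C (tensorMapEE A f t) :=
  (tensorMap A f).comm_P t

/-- The functor `A ⊛ -` preserves exactness of sequences `B₁ → B → B₂ → 0`. -/
theorem RightExact.tensorLeft_map {μ : B₁ ⟶ B} {σ : B ⟶ B₂} (h : RightExact μ σ) :
    RightExact ((tensorLeft A).map μ) ((tensorLeft A).map σ) where
  surjective_e := tensorMapE_surjective σ h.surjective_e h.surjective_ee
  surjective_ee := tensorMapEE_surjective σ h.surjective_ee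
  exact_ee := lTensor_exact A.ee (f := μ.ee.toIntLinearMap) (g := σ.ee.toIntLinearMap)
    h.exact_ee h.surjective_ee
  exact_e u := by
    change tensorMapE A σ u = 0 ↔ u ∈ Set.range (tensorMapE A μ)
    constructor
    · intro hu
      have hμ : ∀ t, tensorMapEE A σ t = 0 → ∃ s, tensorMapEE A μ s = t := fun t ht =>
        (lTensor_exact A.ee (f := μ.ee.toIntLinearMap) (g := σ.ee.toIntLinearMap)
          h.exact_ee h.surjective_ee t).1 ht
      have hz : ∀ v, tensorMapE A σ (tensorMapE A μ v) = 0 := fun v => by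
        induction v using TensorE.induction with
        | zero => simp
        | circ x y => simp [h.exact_e.apply_apply_eq_zero, circ_zero_right]
        | bar a b => simp [h.exact_ee.apply_apply_eq_zero]
        | neg u hu => simp [hu]
        | add u v hu hv => simp [hu, hv]
      -- Conjugating by `w` adds `P` of a cross-effect with an element from `B₁`. This cross-effect
      -- dies under `σ`, so by exactness of the ordinary tensor product it comes from `A_ee ⊗
      -- (B₁)_ee`, and the conjugate stays in the range.
      have hn : (tensorMapE A μ).range.Normal := ⟨by
        rintro _ ⟨v, rfl⟩ w
        obtain ⟨s, hs⟩ := hμ (rho A B (tensorπ A B w) (tensorπ A B (tensorMapE A μ v))) (by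
          rw [tensorMap_rho, hz]; simp)
        refine ⟨v + tensorP A B₁ s, ?_⟩
        rw [tensor_comm A B w, map_add, tensorMapE_tensorP, hs,
          add_assoc (_ + w), tensorP_central A B]
        simp [add_assoc]⟩
      exact ker_tensorMapE_le σ h.surjective_e h.surjective_ee (tensorMapE A μ).range
        (fun x y hy => by
          obtain ⟨z, rfl⟩ := (h.exact_e y).1 hy
          exact ⟨circ x z, by simp⟩)
        (fun x y hy => by
          obtain ⟨z, rfl⟩ := (h.exact_ee y).1 hy
          exact ⟨bar x z, by simp⟩) hu
    · rintro ⟨v, rfl⟩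
      induction v using TensorE.induction with
      | zero => simp
      | circ x y => simp [h.exact_e.apply_apply_eq_zero, circ_zero_right]
      | bar a b => simp [h.exact_ee.apply_apply_eq_zero]
      | neg u hu => simp [hu]
      | add u v hu hv => simp [hu, hv]

theorem ShortExact.rightExact {μ : B₁ ⟶ B} {σ : B ⟶ B₂} (h : ShortExact μ σ) :
    RightExact μ σ :=
  ⟨h.exact_e, h.exact_ee, h.surjective_e, h.surjective_ee⟩

end RightExact

end SquareGroup

namespace SquareGroup

/-! ### Quotients by ideals and reflexive coequalizers. -/

section Coequalizer

variable (C : SquareGroup.{u})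

/-- The quotient of a square group by an ideal, that is a pair of subgroups stable under the
structure maps. -/
def quotient (N : AddSubgroup C.e) [N.Normal] (K : AddSubgroup C.ee)
    (hP : ∀ a ∈ K, C.P a ∈ N) (hH : ∀ x ∈ N, C.H x ∈ K) (hcr : ∀ x, ∀ n ∈ N, C.cr x n ∈ K) :
    SquareGroup.{u} where
  e := C.e ⧸ N
  ee := C.ee ⧸ K
  P := QuotientAddGroup.map K N C.P hP
  -- With `y = x + (-x + y)`, only a cross-effect whose second argument lies in `N` has to be
  -- absorbed by `K`.
  H := Quotient.map' C.H (fun x y h => by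
    have h' : -x + y ∈ N := QuotientAddGroup.leftRel_apply.1 h
    refine QuotientAddGroup.leftRel_apply.2 ?_
    have e : C.H y = C.H x + C.H (-x + y) + C.cr x (-x + y) := by
      rw [← H_add, add_neg_cancel_left]
    rw [e, add_assoc, neg_add_cancel_left]
    exact K.add_mem (hH _ h') (hcr _ _ h'))
  quadratic :=
    ⟨by rintro ⟨x⟩ ⟨x'⟩ ⟨y⟩; exact congrArg (QuotientAddGroup.mk' K) (C.cr_add_left x x' y),
      by rintro ⟨x⟩ ⟨y⟩ ⟨y'⟩; exact congrArg (QuotientAddGroup.mk' K) (C.cr_add_right x y y')⟩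
  cross_P_left := by
    rintro ⟨a⟩ ⟨y⟩; exact congrArg (QuotientAddGroup.mk' K) (C.cr_P_left a y)
  cross_P_right := by
    rintro ⟨x⟩ ⟨b⟩; exact congrArg (QuotientAddGroup.mk' K) (C.cr_P_right x b)
  P_cross := by
    rintro ⟨x⟩ ⟨y⟩; exact congrArg (QuotientAddGroup.mk' N) (C.P_cr x y)
  PHP := by
    rintro ⟨a⟩; exact congrArg (QuotientAddGroup.mk' N) (C.PHP a)

/-- The projection to the quotient by an ideal. -/
def quotientMk (N : AddSubgroup C.e) [N.Normal] (K : AddSubgroup C.ee)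
    (hP : ∀ a ∈ K, C.P a ∈ N) (hH : ∀ x ∈ N, C.H x ∈ K) (hcr : ∀ x, ∀ n ∈ N, C.cr x n ∈ K) :
    C ⟶ quotient C N K hP hH hcr where
  e := QuotientAddGroup.mk' N
  ee := QuotientAddGroup.mk' K
  comm_P _ := rfl
  comm_H _ := rfl

variable {C} {B Q : SquareGroup.{u}} {f g : B ⟶ C}

/-- `q` is surjective with kernel `f (ker g)` on both levels. -/
structure IsRegularQuotient (f g : B ⟶ C) (q : C ⟶ Q) : Prop where
  surjective_e : Function.Surjective q.e
  surjective_ee : Function.Surjective q.ee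
  ker_e : ∀ y, q.e y = 0 → ∃ b, g.e b = 0 ∧ f.e b = y
  ker_ee : ∀ y, q.ee y = 0 → ∃ b, g.ee b = 0 ∧ f.ee b = y

/-- A morphism that coequalizes `f` and `g` and is surjective with kernel `f (ker g)` is their
coequalizer. -/
noncomputable def IsRegularQuotient.isColimit {q : C ⟶ Q} (h : IsRegularQuotient f g q)
    (w : f ≫ q = g ≫ q) : IsColimit (Cofork.ofπ q w) :=
  Cofork.IsColimit.mk' _ fun s => by
    have he : q.e.ker ≤ s.π.e.ker := fun y hy => by
      obtain ⟨b, hb, rfl⟩ := h.ker_e y hy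
      rw [AddMonoidHom.mem_ker, ← comp_e, s.condition, comp_e, hb, map_zero]
    have hee : q.ee.ker ≤ s.π.ee.ker := fun y hy => by
      obtain ⟨b, hb, rfl⟩ := h.ker_ee y hy
      rw [AddMonoidHom.mem_ker, ← comp_ee, s.condition, comp_ee, hb, map_zero]
    let le := q.e.liftOfSurjective h.surjective_e ⟨s.π.e, he⟩
    let lee := q.ee.liftOfSurjective h.surjective_ee ⟨s.π.ee, hee⟩
    have ce : ∀ y, le (q.e y) = s.π.e y := fun y =>
      q.e.liftOfRightInverse_comp_apply _ _ ⟨s.π.e, he⟩ y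
    have cee : ∀ y, lee (q.ee y) = s.π.ee y := fun y =>
      q.ee.liftOfRightInverse_comp_apply _ _ ⟨s.π.ee, hee⟩ y
    refine ⟨⟨le, lee, fun a => ?_, fun x => ?_⟩, ?_, fun {m} hm => ?_⟩
    · obtain ⟨a, rfl⟩ := h.surjective_ee a
      exact (congrArg le (q.comm_P a)).symm.trans
        ((ce _).trans ((s.π.comm_P a).trans (congrArg s.pt.P (cee a).symm)))
    · obtain ⟨x, rfl⟩ := h.surjective_e x
      exact (congrArg lee (q.comm_H x)).symm.trans
        ((cee _).trans ((s.π.comm_H x).trans (congrArg s.pt.H (ce x).symm)))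
    · ext y
      · exact ce y
      · exact cee y
    · ext y
      · obtain ⟨y, rfl⟩ := h.surjective_e y
        exact (DFunLike.congr_fun (congrArg Hom.e hm) y).trans (ce y).symm
      · obtain ⟨y, rfl⟩ := h.surjective_ee y
        exact (DFunLike.congr_fun (congrArg Hom.ee hm) y).trans (cee y).symm

theorem section_e {s : C ⟶ B} (h : s ≫ f = 𝟙 C) (x : C.e) : f.e (s.e x) = x :=
  DFunLike.congr_fun (congrArg Hom.e h) x

theorem section_ee {s : C ⟶ B} (h : s ≫ f = 𝟙 C) (x : C.ee) : f.ee (s.ee x) = x :=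
  DFunLike.congr_fun (congrArg Hom.ee h) x

/-- A reflexive pair has a levelwise coequalizer. -/
theorem exists_isRegularQuotient [IsReflexivePair f g] :
    ∃ (Q : SquareGroup.{u}) (q : C ⟶ Q), IsRegularQuotient f g q ∧ f ≫ q = g ≫ q := by
  obtain ⟨s, hf, hg⟩ := IsReflexivePair.common_section f g
  -- The common section makes `f` surjective, so it carries normal subgroups to normal subgroups.
  have hn : (g.e.ker.map f.e).Normal :=
    AddSubgroup.Normal.map inferInstance _ fun x => ⟨_, section_e hf x⟩
  let q := quotientMk C (g.e.ker.map f.e) (g.ee.ker.map f.ee)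
    (by
      rintro _ ⟨a, ha, rfl⟩
      refine ⟨B.P a, ?_, f.comm_P a⟩
      rw [SetLike.mem_coe, AddMonoidHom.mem_ker, g.comm_P, AddMonoidHom.mem_ker.1 ha, map_zero])
    (by
      rintro _ ⟨x, hx, rfl⟩
      refine ⟨B.H x, ?_, f.comm_H x⟩
      rw [SetLike.mem_coe, AddMonoidHom.mem_ker, g.comm_H, AddMonoidHom.mem_ker.1 hx, H_zero])
    (by
      rintro x _ ⟨y, hy, rfl⟩
      -- Since `f (s x) = x`, the cross-effect of `x` and `f y` is the image of that of `s x` and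
      -- `y`, and `g` kills the latter along with `y`.
      refine ⟨B.cr (s.e x) y, ?_, ?_⟩
      · rw [SetLike.mem_coe, AddMonoidHom.mem_ker, g.map_cr, AddMonoidHom.mem_ker.1 hy,
          cr_zero_right]
      · rw [f.map_cr, section_e hf])
  refine ⟨_, q, ⟨QuotientAddGroup.mk'_surjective _, QuotientAddGroup.mk'_surjective _,
    fun y hy => (QuotientAddGroup.eq_zero_iff y).1 hy,
    fun y hy => (QuotientAddGroup.eq_zero_iff y).1 hy⟩, ?_⟩
  ext b
  -- The elements `f b` and `g b = f (s (g b))` differ by `f` of an element that `g` kills.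
  · refine QuotientAddGroup.eq.2 ⟨-b + s.e (g.e b), ?_, ?_⟩
    · rw [SetLike.mem_coe, AddMonoidHom.mem_ker, map_add, map_neg, section_e hg, neg_add_cancel]
    · rw [map_add, map_neg, section_e hf]
  · refine QuotientAddGroup.eq.2 ⟨-b + s.ee (g.ee b), ?_, ?_⟩
    · rw [SetLike.mem_coe, AddMonoidHom.mem_ker, map_add, map_neg, section_ee hg, neg_add_cancel]
    · rw [map_add, map_neg, section_ee hf]

/-- The kernel of `A ⊛ q` is generated by generators with second entry `f z`, where `g z = 0`. Each
is the image under `A ⊛ f` of a generator killed by `A ⊛ g`. Reflexivity is needed again to make the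
image subgroup normal. -/
theorem IsRegularQuotient.tensorLeft_map (A : SquareGroup.{u}) [IsReflexivePair f g] {q : C ⟶ Q}
    (h : IsRegularQuotient f g q) :
    IsRegularQuotient ((tensorLeft A).map f) ((tensorLeft A).map g) ((tensorLeft A).map q) where
  surjective_e := tensorMapE_surjective q h.surjective_e h.surjective_ee
  surjective_ee := tensorMapEE_surjective q h.surjective_ee
  ker_e y hy := by
    obtain ⟨s, hf, hg⟩ := IsReflexivePair.common_section f g
    have hn : ((tensorMapE A g).ker.map (tensorMapE A f)).Normal :=
      AddSubgroup.Normal.map inferInstance _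
        (tensorMapE_surjective f (fun x => ⟨_, section_e hf x⟩) fun x => ⟨_, section_ee hf x⟩)
    refine ker_tensorMapE_le q h.surjective_e h.surjective_ee
      ((tensorMapE A g).ker.map (tensorMapE A f)) (fun x y hy => ?_) (fun a b hb => ?_) hy
    · obtain ⟨z, hz, rfl⟩ := h.ker_e y hy
      exact ⟨circ x z, by simp [hz, circ_zero_right], by simp⟩
    · obtain ⟨z, hz, rfl⟩ := h.ker_ee b hb
      exact ⟨bar a z, by simp [hz], by simp⟩
  ker_ee y hy := by
    refine ker_tensorMapEE_le q h.surjective_ee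
      ((tensorMapEE A g).ker.map (tensorMapEE A f)) (fun a b hb => ?_) hy
    obtain ⟨z, hz, rfl⟩ := h.ker_ee b hb
    exact ⟨a ⊗ₜ z, by simp [hz], by simp⟩

/-- The functor `A ⊛ -` preserves reflexive coequalizers. -/
theorem preservesColimit_parallelPair (A : SquareGroup.{u}) (f g : B ⟶ C) [IsReflexivePair f g] :
    PreservesColimit (parallelPair f g) (tensorLeft A) := by
  obtain ⟨Q, q, hq, w⟩ := exists_isRegularQuotient (f := f) (g := g)
  refine preservesColimit_of_preserves_colimit_cocone (hq.isColimit w) ?_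
  exact (isColimitMapCoconeCoforkEquiv (tensorLeft A) w).symm
    ((hq.tensorLeft_map A).isColimit (by rw [← Functor.map_comp, w, Functor.map_comp]))

end Coequalizer

/-! ### Finite products. -/

section Product

variable {B B' D : SquareGroup.{u}}

/-- A binary fan of square groups which is a product on both levels is a product. -/
noncomputable def isLimitBinaryFan {p : D ⟶ B} {p' : D ⟶ B'}
    (he : Function.Bijective (p.e.prod p'.e)) (hee : Function.Bijective (p.ee.prod p'.ee)) :
    IsLimit (BinaryFan.mk p p') :=
  let E := AddEquiv.ofBijective (p.e.prod p'.e) he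
  let EE := AddEquiv.ofBijective (p.ee.prod p'.ee) hee
  have h₁ : ∀ x, p.e (E.symm x) = x.1 := fun x => congrArg Prod.fst (E.apply_symm_apply x)
  have h₂ : ∀ x, p'.e (E.symm x) = x.2 := fun x => congrArg Prod.snd (E.apply_symm_apply x)
  have k₁ : ∀ x, p.ee (EE.symm x) = x.1 := fun x => congrArg Prod.fst (EE.apply_symm_apply x)
  have k₂ : ∀ x, p'.ee (EE.symm x) = x.2 := fun x => congrArg Prod.snd (EE.apply_symm_apply x)
  BinaryFan.IsLimit.mk _
    (fun {T} f g => ⟨E.symm.toAddMonoidHom.comp (f.e.prod g.e),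
      EE.symm.toAddMonoidHom.comp (f.ee.prod g.ee),
      fun a => he.1 (Prod.ext
        (by
          change p.e (E.symm _) = p.e (D.P (EE.symm _))
          rw [h₁, p.comm_P, k₁]; exact f.comm_P a)
        (by
          change p'.e (E.symm _) = p'.e (D.P (EE.symm _))
          rw [h₂, p'.comm_P, k₂]; exact g.comm_P a)),
      fun x => hee.1 (Prod.ext
        (by
          change p.ee (EE.symm _) = p.ee (D.H (E.symm _))
          rw [k₁, p.comm_H, h₁]; exact f.comm_H x)
        (by
          change p'.ee (EE.symm _) = p'.ee (D.H (E.symm _))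
          rw [k₂, p'.comm_H, h₂]; exact g.comm_H x))⟩)
    (fun f g => by
      ext x
      · exact h₁ _
      · exact k₁ _)
    (fun f g => by
      ext x
      · exact h₂ _
      · exact k₂ _)
    (fun {T} f g m hf hg => by
      subst hf hg
      ext x
      · exact (E.symm_apply_apply (m.e x)).symm
      · exact (EE.symm_apply_apply (m.ee x)).symm)

variable (B B')

/-- The product of two square groups. -/
def prod : SquareGroup.{u} where
  e := B.e × B'.e
  ee := B.ee × B'.ee
  P := B.P.prodMap B'.P
  H x := (B.H x.1, B'.H x.2)
  quadratic :=
    ⟨fun x x' y => Prod.ext (B.cr_add_left x.1 x'.1 y.1) (B'.cr_add_left x.2 x'.2 y.2),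
      fun x y y' => Prod.ext (B.cr_add_right x.1 y.1 y'.1) (B'.cr_add_right x.2 y.2 y'.2)⟩
  cross_P_left a y := Prod.ext (B.cr_P_left a.1 y.1) (B'.cr_P_left a.2 y.2)
  cross_P_right x b := Prod.ext (B.cr_P_right x.1 b.1) (B'.cr_P_right x.2 b.2)
  P_cross x y := Prod.ext (B.P_cr x.1 y.1) (B'.P_cr x.2 y.2)
  PHP a := Prod.ext (B.PHP a.1) (B'.PHP a.2)

/-- The projection to the first factor. -/
def prodFst : prod B B' ⟶ B :=
  ⟨AddMonoidHom.fst _ _, AddMonoidHom.fst _ _, fun _ => rfl, fun _ => rfl⟩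

/-- The projection to the second factor. -/
def prodSnd : prod B B' ⟶ B' :=
  ⟨AddMonoidHom.snd _ _, AddMonoidHom.snd _ _, fun _ => rfl, fun _ => rfl⟩

/-- The inclusion of the first factor. -/
def prodInl : B ⟶ prod B B' :=
  ⟨AddMonoidHom.inl _ _, AddMonoidHom.inl _ _,
    fun _ => Prod.ext rfl (map_zero B'.P).symm, fun _ => Prod.ext rfl B'.H_zero.symm⟩

/-- The inclusion of the second factor. -/
def prodInr : B' ⟶ prod B B' :=
  ⟨AddMonoidHom.inr _ _, AddMonoidHom.inr _ _,
    fun _ => Prod.ext (map_zero B.P).symm rfl, fun _ => Prod.ext B.H_zero.symm rfl⟩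

variable (A : SquareGroup.{u})

/-- The commutator is `P` of the cross-effect, and on generators this contains the factor `((y, 0) |
(0, y'))_H`, which is zero in each component. -/
theorem tensorMapE_prodInl_comm (u : TensorE A B) (v : TensorE A B') :
    tensorMapE A (prodInl B B') u + tensorMapE A (prodInr B B') v
      = tensorMapE A (prodInr B B') v + tensorMapE A (prodInl B B') u := by
  have h : rho A (prod B B') (tensorπ A _ (tensorMapE A (prodInl B B') u))
      (tensorπ A _ (tensorMapE A (prodInr B B') v)) = 0 := by
    induction u using TensorE.induction with
    | zero => simp
    | bar a b => simp
    | neg u h => simp [tensorπ_neg, h]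
    | add u u' h h' => simp [tensorπ_add, h, h']
    | circ x y =>
      induction v using TensorE.induction with
      | zero => simp
      | bar a b => simp
      | neg v h => simp only [tensorπ_neg, map_neg, h, neg_zero]
      | add v v' h h' => simp only [tensorπ_add, map_add, h, h', add_zero]
      | circ x' y' =>
        have : (prod B B').cr ((prodInl B B').e y) ((prodInr B B').e y') = 0 :=
          Prod.ext (B.cr_zero_right y) (B'.cr_zero_left y')
        simp [this]
  rw [tensor_comm, h, map_zero, add_zero]

theorem tensorMapE_zero {f : B ⟶ B'} (he : ∀ y, f.e y = 0) (hee : ∀ b, f.ee b = 0)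
    (u : TensorE A B) : tensorMapE A f u = 0 :=
  DFunLike.congr_fun (TensorE.hom_ext (g := tensorMapE A f) (h := 0)
    (by simp [he, circ_zero_right]) (by simp [hee])) u

theorem tensorMapE_id (u : TensorE A B) : tensorMapE A (𝟙 B) u = u :=
  DFunLike.congr_fun (TensorE.hom_ext (g := tensorMapE A (𝟙 B)) (h := AddMonoidHom.id _)
    (by simp) (by simp)) u

theorem tensorMapEE_zero {f : B ⟶ B'} (hee : ∀ b, f.ee b = 0) (t : A.ee ⊗[ℤ] B.ee) :
    tensorMapEE A f t = 0 := by
  induction t using TensorProduct.induction_on with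
  | zero => simp
  | tmul a b => simp [hee]
  | add s t hs ht => rw [map_add, hs, ht, add_zero]

theorem tensorMapEE_id (t : A.ee ⊗[ℤ] B.ee) : tensorMapEE A (𝟙 B) t = t := by
  induction t using TensorProduct.induction_on with
  | zero => simp
  | tmul a b => simp
  | add s t hs ht => rw [map_add, hs, ht]

/-- Including after projecting, summed over the two factors, is a homomorphism since the two images
commute. It fixes the generators because `y = (y₁, 0) + (0, y₂)` and generators are additive on the
right. This gives injectivity; surjectivity comes from the composites of inclusions and projections,
which are identities or zero. -/
theorem tensorMapE_prod_bijective : Function.Bijective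
    ((tensorMapE A (prodFst B B')).prod (tensorMapE A (prodSnd B B'))) := by
  let φ : TensorE A (prod B B') →+ TensorE A (prod B B') :=
    AddMonoidHom.mk' (fun u =>
      tensorMapE A (prodInl B B') (tensorMapE A (prodFst B B') u)
        + tensorMapE A (prodInr B B') (tensorMapE A (prodSnd B B') u)) (fun u v => by
      simp only [map_add]
      rw [add_assoc, ← add_assoc (tensorMapE A (prodInl B B') _) (tensorMapE A (prodInr B B') _),
        tensorMapE_prodInl_comm]
      simp only [add_assoc])
  have hφ : φ = AddMonoidHom.id _ := by
    refine TensorE.hom_ext (fun x y => ?_) (fun a b => ?_)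
    · change tensorMapE A (prodInl B B') (tensorMapE A (prodFst B B') (circ x y))
        + tensorMapE A (prodInr B B') (tensorMapE A (prodSnd B B') (circ x y)) = circ x y
      simp only [tensorMapE_circ]
      rw [← circ_add_right]
      exact congrArg (circ x) (Prod.ext (add_zero _) (zero_add _))
    · change tensorMapE A (prodInl B B') (tensorMapE A (prodFst B B') (bar a b))
        + tensorMapE A (prodInr B B') (tensorMapE A (prodSnd B B') (bar a b)) = bar a b
      simp only [tensorMapE_bar]
      rw [← bar_add_right]
      exact congrArg (bar a) (Prod.ext (add_zero _) (zero_add _))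
  constructor
  · intro u v h
    have h' : φ u = φ v := by
      have h₁ : tensorMapE A (prodFst B B') u = tensorMapE A (prodFst B B') v :=
        congrArg Prod.fst h
      have h₂ : tensorMapE A (prodSnd B B') u = tensorMapE A (prodSnd B B') v :=
        congrArg Prod.snd h
      change tensorMapE A _ (tensorMapE A _ u) + tensorMapE A _ (tensorMapE A _ u) = _
      rw [h₁, h₂]; rfl
    simpa [hφ] using h'
  · rintro ⟨u, v⟩
    refine ⟨tensorMapE A (prodInl B B') u + tensorMapE A (prodInr B B') v, Prod.ext ?_ ?_⟩
    · change tensorMapE A _ _ = u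
      rw [map_add, ← tensorMapE_comp, ← tensorMapE_comp,
        tensorMapE_zero _ _ _ (f := prodInr B B' ≫ prodFst B B') (fun _ => rfl) (fun _ => rfl)]
      exact (add_zero _).trans (tensorMapE_id _ A u)
    · change tensorMapE A _ _ = v
      rw [map_add, ← tensorMapE_comp, ← tensorMapE_comp,
        tensorMapE_zero _ _ _ (f := prodInl B B' ≫ prodSnd B B') (fun _ => rfl) (fun _ => rfl)]
      exact (zero_add _).trans (tensorMapE_id _ A v)

theorem tensorMapEE_prod_bijective : Function.Bijective
    ((tensorMapEE A (prodFst B B')).prod (tensorMapEE A (prodSnd B B'))) := by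
  have hφ : ∀ t, tensorMapEE A (prodInl B B') (tensorMapEE A (prodFst B B') t)
      + tensorMapEE A (prodInr B B') (tensorMapEE A (prodSnd B B') t) = t := fun t => by
    induction t using TensorProduct.induction_on with
    | zero => simp
    | tmul a b =>
      simp only [tensorMapEE_tmul]
      rw [← TensorProduct.tmul_add]
      exact congrArg (a ⊗ₜ[ℤ] ·) (Prod.ext (add_zero _) (zero_add _))
    | add s t hs ht =>
      simp only [map_add]
      rw [add_add_add_comm, hs, ht]
  constructor
  · intro u v h
    have h₁ : tensorMapEE A (prodFst B B') u = tensorMapEE A (prodFst B B') v :=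
      congrArg Prod.fst h
    have h₂ : tensorMapEE A (prodSnd B B') u = tensorMapEE A (prodSnd B B') v :=
      congrArg Prod.snd h
    rw [← hφ u, h₁, h₂, hφ]
  · rintro ⟨u, v⟩
    refine ⟨tensorMapEE A (prodInl B B') u + tensorMapEE A (prodInr B B') v, Prod.ext ?_ ?_⟩
    · change tensorMapEE A _ _ = u
      rw [map_add, ← tensorMapEE_comp, ← tensorMapEE_comp,
        tensorMapEE_zero _ _ _ (f := prodInr B B' ≫ prodFst B B') (fun _ => rfl)]
      exact (add_zero _).trans (tensorMapEE_id _ A u)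
    · change tensorMapEE A _ _ = v
      rw [map_add, ← tensorMapEE_comp, ← tensorMapEE_comp,
        tensorMapEE_zero _ _ _ (f := prodInl B B' ≫ prodSnd B B') (fun _ => rfl)]
      exact (zero_add _).trans (tensorMapEE_id _ A v)

/-- The product fan of two square groups is a limit. -/
noncomputable def isLimitProd : IsLimit (BinaryFan.mk (prodFst B B') (prodSnd B B')) :=
  isLimitBinaryFan Function.bijective_id Function.bijective_id

/-- A square group which is trivial on both levels is terminal. -/
def isTerminalOfSubsingleton (Z : SquareGroup.{u}) [Subsingleton Z.e] [Subsingleton Z.ee] :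
    IsTerminal Z :=
  IsTerminal.ofUniqueHom (fun _ => ⟨0, 0, fun _ => Subsingleton.elim _ _,
      fun _ => Subsingleton.elim _ _⟩)
    (fun _ _ => by ext <;> exact Subsingleton.elim _ _)

/-- The trivial square group. -/
def trivial : SquareGroup.{u} where
  e := PUnit
  ee := PUnit
  P := 0
  H _ := 0
  quadratic := ⟨fun _ _ _ => rfl, fun _ _ _ => rfl⟩
  cross_P_left _ _ := rfl
  cross_P_right _ _ := rfl
  P_cross _ _ := rfl
  PHP _ := rfl

instance : Subsingleton trivial.{u}.e := inferInstanceAs (Subsingleton PUnit)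
instance : Subsingleton trivial.{u}.ee := inferInstanceAs (Subsingleton PUnit)

/-- The functor `A ⊛ -` preserves finite products. -/
theorem preservesFiniteProducts_tensorLeft : PreservesFiniteProducts (tensorLeft A) := by
  have : HasBinaryProducts SquareGroup.{u} :=
    have (B B' : SquareGroup.{u}) : HasLimit (pair B B') := ⟨⟨_, isLimitProd B B'⟩⟩
    hasBinaryProducts_of_hasLimit_pair _
  have : HasTerminal SquareGroup.{u} := (isTerminalOfSubsingleton trivial).hasTerminal
  have : HasFiniteProducts SquareGroup.{u} := hasFiniteProducts_of_has_binary_and_terminal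
  have h₂ (B B' : SquareGroup.{u}) : PreservesLimit (pair B B') (tensorLeft A) :=
    preservesLimit_of_preserves_limit_cone (isLimitProd B B')
      ((isLimitMapConeBinaryFanEquiv (tensorLeft A) _ _).symm
        (isLimitBinaryFan (tensorMapE_prod_bijective B B' A) (tensorMapEE_prod_bijective B B' A)))
  have : PreservesLimitsOfShape (Discrete WalkingPair) (tensorLeft A) :=
    ⟨fun {K} => preservesLimit_of_iso_diagram _ (diagramIsoPair K).symm⟩
  have h₀ : IsTerminal ((tensorLeft A).obj trivial) := by
    have : Subsingleton ((tensorLeft A).obj trivial.{u}).e := by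
      refine subsingleton_of_forall_eq (0 : TensorE A trivial) fun u => ?_
      -- The identity of the trivial square group is also zero, so it induces both the identity and
      -- zero on the tensor product.
      have h := tensorMapE_zero trivial trivial A (f := 𝟙 _) (fun _ => Subsingleton.elim _ _)
        (fun _ => Subsingleton.elim _ _) u
      exact (tensorMapE_id _ A u).symm.trans h
    have : Subsingleton ((tensorLeft A).obj trivial.{u}).ee :=
      inferInstanceAs (Subsingleton (A.ee ⊗[ℤ] trivial.{u}.ee))
    exact isTerminalOfSubsingleton _
  have : PreservesLimit (Functor.empty.{0} SquareGroup.{u}) (tensorLeft A) :=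
    preservesLimit_of_preserves_limit_cone (isTerminalOfSubsingleton trivial)
      ((isLimitMapConeEmptyConeEquiv _ _).symm h₀)
  have := preservesLimitsOfShape_pempty_of_preservesTerminal (tensorLeft A)
  exact PreservesFiniteProducts.of_preserves_binary_and_terminal _

end Product

end SquareGroup

/-! ### Filtered colimits. -/

/-- A compatible family of homomorphisms out of a directed jointly surjective family extends to
a homomorphism. -/
theorem exists_addMonoidHom_desc {J Q G : Type*} [AddGroup Q] [AddGroup G] {C : J → Type*}
    [∀ j, AddGroup (C j)] (q : ∀ j, C j →+ Q)
    (pair : ∀ y y', ∃ j z z', q j z = y ∧ q j z' = y') (h : ∀ j, C j →+ G)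
    (hc : ∀ j k y y', q j y = q k y' → h j y = h k y') :
    ∃ g : Q →+ G, ∀ j y, g (q j y) = h j y := by
  have surj : ∀ y, ∃ j z, q j z = y := fun y => by
    obtain ⟨j, z, -, hz, -⟩ := pair y y
    exact ⟨j, z, hz⟩
  choose je se hse using surj
  have key : ∀ j y, h (je (q j y)) (se (q j y)) = h j y := fun j y => hc _ _ _ _ (hse _)
  refine ⟨AddMonoidHom.mk' (fun y => h (je y) (se y)) fun y y' => ?_, key⟩
  obtain ⟨j, z, z', rfl, rfl⟩ := pair y y'
  rw [key, key, ← map_add, key, map_add]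

namespace SquareGroup

section Filtered

variable {J : Type u} [Category.{u} J] {K : J ⥤ SquareGroup.{u}}

/-- A cocone over a filtered diagram of square groups which is a colimit of sets on both levels:
every element comes from the diagram, and elements are identified only if they are identified at
a later stage. -/
structure IsLevelwiseColimit (t : Cocone K) : Prop where
  surj_e : ∀ y : t.pt.e, ∃ j z, (t.ι.app j).e z = y
  surj_ee : ∀ b : t.pt.ee, ∃ j z, (t.ι.app j).ee z = b
  eq_e : ∀ i j x y, (t.ι.app i).e x = (t.ι.app j).e y →
    ∃ k, ∃ (f : i ⟶ k) (g : j ⟶ k), (K.map f).e x = (K.map g).e y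
  eq_ee : ∀ i j x y, (t.ι.app i).ee x = (t.ι.app j).ee y →
    ∃ k, ∃ (f : i ⟶ k) (g : j ⟶ k), (K.map f).ee x = (K.map g).ee y

theorem cocone_w_e (t : Cocone K) {i j : J} (f : i ⟶ j) (x : (K.obj i).e) :
    (t.ι.app j).e ((K.map f).e x) = (t.ι.app i).e x :=
  DFunLike.congr_fun (congrArg Hom.e (t.w f)) x

theorem cocone_w_ee (t : Cocone K) {i j : J} (f : i ⟶ j) (x : (K.obj i).ee) :
    (t.ι.app j).ee ((K.map f).ee x) = (t.ι.app i).ee x :=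
  DFunLike.congr_fun (congrArg Hom.ee (t.w f)) x

variable [IsFiltered J]

namespace IsLevelwiseColimit

variable {t : Cocone K}

theorem pair_e (ht : IsLevelwiseColimit t) (y y' : t.pt.e) :
    ∃ j z z', (t.ι.app j).e z = y ∧ (t.ι.app j).e z' = y' := by
  obtain ⟨i, x, rfl⟩ := ht.surj_e y
  obtain ⟨j, x', rfl⟩ := ht.surj_e y'
  exact ⟨_, (K.map (IsFiltered.leftToMax i j)).e x, (K.map (IsFiltered.rightToMax i j)).e x',
    cocone_w_e t _ _, cocone_w_e t _ _⟩

theorem pair_ee (ht : IsLevelwiseColimit t) (y y' : t.pt.ee) :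
    ∃ j z z', (t.ι.app j).ee z = y ∧ (t.ι.app j).ee z' = y' := by
  obtain ⟨i, x, rfl⟩ := ht.surj_ee y
  obtain ⟨j, x', rfl⟩ := ht.surj_ee y'
  exact ⟨_, (K.map (IsFiltered.leftToMax i j)).ee x, (K.map (IsFiltered.rightToMax i j)).ee x',
    cocone_w_ee t _ _, cocone_w_ee t _ _⟩

/-- A levelwise filtered colimit is a colimit. -/
theorem nonempty_isColimit (ht : IsLevelwiseColimit t) : Nonempty (IsColimit t) := by
  refine ⟨IsColimit.ofExistsUnique fun s => ?_⟩
  obtain ⟨d, hd⟩ := exists_addMonoidHom_desc (Q := t.pt.e) (G := s.pt.e)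
    (C := fun j => (K.obj j).e) (fun j => (t.ι.app j).e) ht.pair_e (fun j => (s.ι.app j).e)
    (fun i j x y h => by
      obtain ⟨k, f, g, e⟩ := ht.eq_e i j x y h
      exact (cocone_w_e s f x).symm.trans
        ((congrArg (s.ι.app k).e e).trans (cocone_w_e s g y)))
  obtain ⟨dd, hdd⟩ := exists_addMonoidHom_desc (Q := t.pt.ee) (G := s.pt.ee)
    (C := fun j => (K.obj j).ee) (fun j => (t.ι.app j).ee) ht.pair_ee (fun j => (s.ι.app j).ee)
    (fun i j x y h => by
      obtain ⟨k, f, g, e⟩ := ht.eq_ee i j x y h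
      exact (cocone_w_ee s f x).symm.trans
        ((congrArg (s.ι.app k).ee e).trans (cocone_w_ee s g y)))
  refine ⟨⟨d, dd, fun a => ?_, fun x => ?_⟩, fun j => ?_, fun m hm => ?_⟩
  · obtain ⟨j, a, rfl⟩ := ht.surj_ee a
    exact (congrArg d ((t.ι.app j).comm_P a)).symm.trans
      ((hd j _).trans (((s.ι.app j).comm_P a).trans (congrArg s.pt.P (hdd j a).symm)))
  · obtain ⟨j, x, rfl⟩ := ht.surj_e x
    exact (congrArg dd ((t.ι.app j).comm_H x)).symm.trans
      ((hdd j _).trans (((s.ι.app j).comm_H x).trans (congrArg s.pt.H (hd j x).symm)))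
  · ext x
    · exact hd j x
    · exact hdd j x
  · ext x
    · obtain ⟨j, x, rfl⟩ := ht.surj_e x
      exact (DFunLike.congr_fun (congrArg Hom.e (hm j)) x).trans (hd j x).symm
    · obtain ⟨j, x, rfl⟩ := ht.surj_ee x
      exact (DFunLike.congr_fun (congrArg Hom.ee (hm j)) x).trans (hdd j x).symm

variable (A : SquareGroup.{u})

/-- An element is a finite word in generators, each of which lives at some stage, and filteredness
supplies a common one. -/
theorem exists_tensorMapE_eq (ht : IsLevelwiseColimit t) (u : TensorE A t.pt) :
    ∃ j v, tensorMapE A (t.ι.app j) v = u := by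
  have lift : ∀ {i j} (f : i ⟶ j) (v : TensorE A (K.obj i)),
      tensorMapE A (t.ι.app j) (tensorMapE A (K.map f) v) = tensorMapE A (t.ι.app i) v :=
    fun {i j} f v => by
      rw [← tensorMapE_comp]
      exact congrArg (fun m => tensorMapE A m v) (t.w f)
  induction u using TensorE.induction with
  | zero =>
    obtain ⟨j, -⟩ := ht.surj_e 0
    exact ⟨j, 0, map_zero _⟩
  | circ x y =>
    obtain ⟨j, z, rfl⟩ := ht.surj_e y
    exact ⟨j, circ x z, tensorMapE_circ _ _ _ _⟩
  | bar a b =>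
    obtain ⟨j, z, rfl⟩ := ht.surj_ee b
    exact ⟨j, bar a z, tensorMapE_bar _ _ _ _⟩
  | neg u hu =>
    obtain ⟨j, v, rfl⟩ := hu
    exact ⟨j, -v, map_neg _ _⟩
  | add u u' hu hu' =>
    obtain ⟨i, v, rfl⟩ := hu
    obtain ⟨j, v', rfl⟩ := hu'
    refine ⟨_, tensorMapE A (K.map (IsFiltered.leftToMax i j)) v
      + tensorMapE A (K.map (IsFiltered.rightToMax i j)) v', ?_⟩
    rw [map_add, lift, lift]

/-- The functor `A ⊛ -` sends levelwise filtered colimits to colimits. -/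
theorem nonempty_isColimit_tensorLeft (ht : IsLevelwiseColimit t) :
    Nonempty (IsColimit ((tensorLeft A).mapCocone t)) := by
  refine ⟨IsColimit.ofExistsUnique fun s => ?_⟩
  let σ : ∀ j, TensorE A (K.obj j) →+ s.pt.e := fun j => (s.ι.app j).e
  let σσ : ∀ j, A.ee ⊗[ℤ] (K.obj j).ee →+ s.pt.ee := fun j => (s.ι.app j).ee
  have hσ : ∀ {i j : J} (f : i ⟶ j) (v : TensorE A (K.obj i)),
      σ j (tensorMapE A (K.map f) v) = σ i v := fun f v => cocone_w_e s f v
  have hσσ : ∀ {i j : J} (f : i ⟶ j) (v : A.ee ⊗[ℤ] (K.obj i).ee),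
      σσ j (tensorMapEE A (K.map f) v) = σσ i v := fun f v => cocone_w_ee s f v
  obtain ⟨d, hd⟩ := exists_tensorE_desc (A := A) (Q := t.pt) K.obj (fun j => t.ι.app j)
    (fun i j => ⟨_, K.map (IsFiltered.leftToMax i j), K.map (IsFiltered.rightToMax i j),
      t.w _, t.w _⟩)
    ht.surj_e ht.surj_ee σ
    (fun i j x y y' h => by
      obtain ⟨k, f, g, e⟩ := ht.eq_e i j y y' h
      rw [← hσ f, ← hσ g, tensorMapE_circ, tensorMapE_circ, e])
    (fun i j x y y' h => by
      obtain ⟨k, f, g, e⟩ := ht.eq_ee i j y y' h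
      rw [← hσ f, ← hσ g, tensorMapE_bar, tensorMapE_bar, e])
  replace hd : ∀ j v, d (tensorMapE A (t.ι.app j) v) = σ j v :=
    fun j v => DFunLike.congr_fun (hd j) v
  -- The map on `A_ee ⊗ colim` is assembled from the additive maps obtained by fixing `a`;
  -- additivity in `a` is then checked on representatives.
  have hex : ∀ a : A.ee, ∃ g : t.pt.ee →+ s.pt.ee,
      ∀ (j : J) (b : (K.obj j).ee), g ((t.ι.app j).ee b) = σσ j (a ⊗ₜ b) := fun a =>
    exists_addMonoidHom_desc (Q := t.pt.ee) (G := s.pt.ee) (C := fun j => (K.obj j).ee)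
      (fun j => (t.ι.app j).ee) ht.pair_ee
      (fun j => (σσ j).comp (TensorProduct.mk ℤ A.ee (K.obj j).ee a).toAddMonoidHom)
      (fun i j x y h => by
        obtain ⟨k, f, g, e⟩ := ht.eq_ee i j x y h
        change σσ i (a ⊗ₜ x) = σσ j (a ⊗ₜ y)
        rw [← hσσ f, ← hσσ g, tensorMapEE_tmul, tensorMapEE_tmul, e])
  choose φ hφ using hex
  let Φ : A.ee →+ t.pt.ee →+ s.pt.ee := AddMonoidHom.mk' φ fun a a' => by
    ext b
    obtain ⟨j, b, rfl⟩ := ht.surj_ee b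
    rw [AddMonoidHom.add_apply, hφ, hφ, hφ, TensorProduct.add_tmul, map_add]
  let dd : A.ee ⊗[ℤ] t.pt.ee →+ s.pt.ee := TensorProduct.liftAddHom Φ fun n a b => by
    rw [map_zsmul, AddMonoidHom.smul_apply, map_zsmul]
  have hdd : ∀ j v, dd (tensorMapEE A (t.ι.app j) v) = σσ j v := fun j v => by
    induction v using TensorProduct.induction_on with
    | zero => simp only [map_zero]
    | tmul a b => exact hφ a j b
    | add v w hv hw => simp only [map_add, hv, hw]
  refine ⟨⟨d, dd, fun v => ?_, fun v => ?_⟩, fun j => ?_, fun m hm => ?_⟩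
  · change d (tensorP A t.pt v) = s.pt.P (dd v)
    induction v using TensorProduct.induction_on with
    | zero => simp
    | tmul a b =>
      obtain ⟨j, b, rfl⟩ := ht.surj_ee b
      rw [← tensorMapEE_tmul, ← tensorMapE_tensorP, hd, hdd]
      exact (s.ι.app j).comm_P _
    | add v w hv hw => simp only [map_add, hv, hw]
  -- Since `v` comes from a single stage, compatibility with the non-additive `H` is inherited from
  -- that stage, with no cross-effects to compute.
  · obtain ⟨j, v, rfl⟩ := ht.exists_tensorMapE_eq A v
    refine (congrArg dd ((tensorMap A (t.ι.app j)).comm_H v)).symm.trans ((hdd j _).trans ?_)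
    exact ((s.ι.app j).comm_H v).trans (congrArg s.pt.H (hd j v).symm)
  · ext x
    · exact hd j x
    · exact hdd j x
  · ext x
    · obtain ⟨j, x, rfl⟩ := ht.exists_tensorMapE_eq A x
      exact (DFunLike.congr_fun (congrArg Hom.e (hm j)) x).trans (hd j x).symm
    · let mm : A.ee ⊗[ℤ] t.pt.ee →+ s.pt.ee := m.ee
      change mm x = dd x
      refine DFunLike.congr_fun (f := mm) (g := dd) ?_ x
      refine AddMonoidHom.ext fun v => ?_
      induction v using TensorProduct.induction_on with
      | zero => rw [map_zero, map_zero]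
      | tmul a b =>
        obtain ⟨j, b, rfl⟩ := ht.surj_ee b
        exact (DFunLike.congr_fun (congrArg Hom.ee (hm j)) (a ⊗ₜ b)).trans (hdd j (a ⊗ₜ b)).symm
      | add v w hv hw => rw [map_add, map_add, hv, hw]

end IsLevelwiseColimit

/-- The `e`-level as a functor. -/
def eFunctor : SquareGroup.{u} ⥤ AddGrpCat.{u} where
  obj B := AddGrpCat.of B.e
  map f := AddGrpCat.ofHom f.e

/-- The `ee`-level as a functor. -/
def eeFunctor : SquareGroup.{u} ⥤ AddCommGrpCat.{u} where
  obj B := AddCommGrpCat.of B.ee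
  map f := AddCommGrpCat.ofHom f.ee

variable (K)

/-- A filtered diagram of square groups has a levelwise colimit. -/
theorem exists_isLevelwiseColimit : ∃ t : Cocone K, IsLevelwiseColimit t := by
  let c := AddGrpCat.FilteredColimits.colimitCocone (K ⋙ eFunctor)
  have hcl : IsColimit c := AddGrpCat.FilteredColimits.colimitCoconeIsColimit (K ⋙ eFunctor)
  let E : AddGrpCat.{u} := c.pt
  let EE : AddCommGrpCat.{u} := colimit (K ⋙ eeFunctor)
  let i : ∀ j, (K.obj j).e →+ E := fun j => (c.ι.app j).hom
  let ii : ∀ j, (K.obj j).ee →+ EE := fun j => (colimit.ι (K ⋙ eeFunctor) j).hom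
  have wi : ∀ {j k : J} (f : j ⟶ k) x, i k ((K.map f).e x) = i j x := fun f x =>
    ConcreteCategory.congr_hom (c.w f) x
  have wii : ∀ {j k : J} (f : j ⟶ k) x, ii k ((K.map f).ee x) = ii j x := fun f x =>
    ConcreteCategory.congr_hom (colimit.w (K ⋙ eeFunctor) f) x
  have surj : ∀ y, ∃ j z, i j z = y := fun y =>
    Concrete.isColimit_exists_rep (K ⋙ eFunctor) hcl y
  have surjj : ∀ y, ∃ j z, ii j z = y := fun y =>
    Concrete.isColimit_exists_rep (K ⋙ eeFunctor) (colimit.isColimit _) y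
  have eqi : ∀ j k x y, i j x = i k y →
      ∃ l, ∃ (f : j ⟶ l) (g : k ⟶ l), (K.map f).e x = (K.map g).e y := fun j k x y h =>
    Concrete.isColimit_exists_of_rep_eq (K ⋙ eFunctor) hcl x y h
  have eqii : ∀ j k x y, ii j x = ii k y →
      ∃ l, ∃ (f : j ⟶ l) (g : k ⟶ l), (K.map f).ee x = (K.map g).ee y := fun j k x y h =>
    Concrete.isColimit_exists_of_rep_eq (K ⋙ eeFunctor) (colimit.isColimit _) x y h
  have pair : ∀ y y', ∃ j z z', i j z = y ∧ i j z' = y' := fun y y' => by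
    obtain ⟨j, x, rfl⟩ := surj y
    obtain ⟨k, x', rfl⟩ := surj y'
    exact ⟨_, _, _, wi (IsFiltered.leftToMax j k) x, wi (IsFiltered.rightToMax j k) x'⟩
  have pairr : ∀ y y', ∃ j z z', ii j z = y ∧ ii j z' = y' := fun y y' => by
    obtain ⟨j, x, rfl⟩ := surjj y
    obtain ⟨k, x', rfl⟩ := surjj y'
    exact ⟨_, _, _, wii (IsFiltered.leftToMax j k) x, wii (IsFiltered.rightToMax j k) x'⟩
  obtain ⟨P, hP⟩ := exists_addMonoidHom_desc ii pairr (fun j => (i j).comp (K.obj j).P)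
    (fun j k x y h => by
      obtain ⟨l, f, g, e⟩ := eqii j k x y h
      simp only [AddMonoidHom.comp_apply]
      rw [← wi f, ← wi g, (K.map f).comm_P, (K.map g).comm_P, e])
  replace hP : ∀ j b, P (ii j b) = i j ((K.obj j).P b) := hP
  -- As `H` is not a homomorphism, the universal property of the group colimit does not provide it;
  -- it is defined on chosen representatives.
  obtain ⟨H, hH⟩ : ∃ H : E → EE, ∀ j x, H (i j x) = ii j ((K.obj j).H x) := by
    choose js s hs using surj
    refine ⟨fun y => ii (js y) ((K.obj (js y)).H (s y)), fun j x => ?_⟩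
    obtain ⟨l, f, g, e⟩ := eqi _ _ _ _ (hs (i j x))
    beta_reduce
    rw [← wii f, ← wii g, (K.map f).comm_H, (K.map g).comm_H, e]
  have hcr : ∀ j x y, crossEffect H (i j x) (i j y) = ii j ((K.obj j).cr x y) :=
    fun j x y => by
      rw [crossEffect, ← map_add, hH, hH, hH, cr, crossEffect, map_sub, map_sub]
  -- Biadditivity of the cross-effect compares three elements, so three have to be brought to one
  -- stage.
  have triple : ∀ y y' y'', ∃ j z z' z'', i j z = y ∧ i j z' = y' ∧ i j z'' = y'' :=
    fun y y' y'' => by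
      obtain ⟨j, x, x', rfl, rfl⟩ := pair y y'
      obtain ⟨k, x'', rfl⟩ := surj y''
      exact ⟨_, _, _, _, wi (IsFiltered.leftToMax j k) x, wi (IsFiltered.leftToMax j k) x',
        wi (IsFiltered.rightToMax j k) x''⟩
  have mixed : ∀ b y, ∃ j z z', ii j z = b ∧ i j z' = y := fun y y' => by
    obtain ⟨j, x, rfl⟩ := surjj y
    obtain ⟨k, x', rfl⟩ := surj y'
    exact ⟨_, _, _, wii (IsFiltered.leftToMax j k) x, wi (IsFiltered.rightToMax j k) x'⟩
  let Q : SquareGroup.{u} :=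
    { e := E
      ee := EE
      P := P
      H := H
      quadratic :=
        ⟨fun x x' y => by
          obtain ⟨j, x, x', y, rfl, rfl, rfl⟩ := triple x x' y
          rw [← map_add, hcr, hcr, hcr, cr_add_left, map_add],
        fun x y y' => by
          obtain ⟨j, x, y, y', rfl, rfl, rfl⟩ := triple x y y'
          rw [← map_add, hcr, hcr, hcr, cr_add_right, map_add]⟩
      cross_P_left := fun a y => by
        obtain ⟨j, a, y, rfl, rfl⟩ := mixed a y
        rw [hP, hcr, cr_P_left, map_zero]
      cross_P_right := fun y a => by
        obtain ⟨j, a, y, rfl, rfl⟩ := mixed a y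
        rw [hP, hcr, cr_P_right, map_zero]
      P_cross := fun x y => by
        obtain ⟨j, x, y, rfl, rfl⟩ := pair x y
        rw [hcr, hP, P_cr, map_add, map_add, map_sub, map_neg]
      PHP := fun a => by
        obtain ⟨j, a, rfl⟩ := surjj a
        rw [hP, hH, hP, (K.obj j).PHP, map_nsmul] }
  refine ⟨⟨Q, ⟨fun j => ⟨i j, ii j, fun a => (hP j a).symm, fun x => (hH j x).symm⟩, ?_⟩⟩,
    surj, surjj, eqi, eqii⟩
  intro j k f
  ext x
  · exact wi f x
  · exact wii f x

/-- The functor `A ⊛ -` preserves filtered colimits. -/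
theorem preservesFilteredColimits_tensorLeft (A : SquareGroup.{u}) :
    PreservesFilteredColimits (tensorLeft A) :=
  ⟨fun _ _ _ => ⟨fun {K} => by
    obtain ⟨t, ht⟩ := exists_isLevelwiseColimit K
    exact preservesColimit_of_preserves_colimit_cocone ht.nonempty_isColimit.some
      (ht.nonempty_isColimit_tensorLeft A).some⟩⟩

end Filtered

end SquareGroup

namespace SquareGroup

/-! ### The image of `P` in the tensor product. -/

section Kernel

variable (M N : SquareGroup.{u})

/-- The homomorphism from `Coker P ⊗ Coker P` to the cokernel of `P` of the tensor product
induced by `x ⊛ y`. -/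
def cokerTensor : M.CokerP ⊗[ℤ] N.CokerP →+ (tensor M N).CokerP :=
  TensorProduct.liftAddHom
    (QuotientAddGroup.lift M.P.range
      (AddMonoidHom.mk' (fun x => QuotientAddGroup.lift N.P.range
          ((tensor M N).toCoker.comp (AddMonoidHom.mk' (circ x) (circ_add_right x) :
            N.e →+ TensorE M N))
          (by
            rintro _ ⟨b, rfl⟩
            change (tensor M N).toCoker (circ x (N.P b)) = 0
            rw [circ_P_right]
            exact (tensor M N).toCoker_P (M.cr x x ⊗ₜ b)))
        (fun x x' => by
          refine QuotientAddGroup.addMonoidHom_ext _ ?_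
          ext y
          change (tensor M N).toCoker (circ (x + x') y)
            = (tensor M N).toCoker (circ x y) + (tensor M N).toCoker (circ x' y)
          have h : (tensor M N).toCoker (bar (M.cr x' x) (N.H y)) = 0 :=
            (tensor M N).toCoker_P (M.cr x' x ⊗ₜ N.H y)
          rw [circ_add_left]
          refine ((tensor M N).toCoker.map_add _ _).trans ?_
          rw [h, add_zero]
          exact (tensor M N).toCoker.map_add _ _))
      (by
        rintro _ ⟨a, rfl⟩
        refine QuotientAddGroup.addMonoidHom_ext _ ?_
        ext y
        change (tensor M N).toCoker (circ (M.P a) y) = 0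
        rw [circ_P_left]
        exact (tensor M N).toCoker_P (a ⊗ₜ N.Δ y)))
    (fun n c d => by rw [map_zsmul, AddMonoidHom.smul_apply, map_zsmul])

/-- The class of `u` modulo `P` factors through `tensorπ`; therefore the kernel of `tensorπ` is no
larger than the image of `P`. -/
theorem cokerTensor_tensorπ (u : TensorE M N) :
    cokerTensor M N (tensorπ M N u) = (tensor M N).toCoker u := by
  induction u using TensorE.induction with
  | zero => rw [tensorπ_zero, map_zero]; exact ((tensor M N).toCoker.map_zero).symm
  | circ x y => rw [tensorπ_circ]; rfl
  | bar a b =>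
    rw [tensorπ_bar, map_zero]
    exact ((tensor M N).toCoker_P (a ⊗ₜ b)).symm
  | neg u h => rw [tensorπ_neg, map_neg, h]; exact ((tensor M N).toCoker.map_neg _).symm
  | add u v h h' => rw [tensorπ_add, map_add, h, h']; exact ((tensor M N).toCoker.map_add _ _).symm

/-- The kernel of the projection of `(M ⊛ N)_e` to `Coker P ⊗ Coker P` is the image of `P`. -/
theorem exists_tensorP_eq {u : TensorE M N} (h : tensorπ M N u = 0) :
    ∃ t, tensorP M N t = u := by
  have h' := cokerTensor_tensorπ M N u
  rw [h, map_zero] at h'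
  exact (QuotientAddGroup.eq_zero_iff (N := (tensor M N).P.range) u).1 h'.symm

/-- `H P = 1 - T ⊗ T` on the tensor product. -/
theorem tensorH_tensorP (t : M.ee ⊗[ℤ] N.ee) : tensorH M N (tensorP M N t)
    = t - TensorProduct.map M.T.toIntLinearMap N.T.toIntLinearMap t := by
  induction t using TensorProduct.induction_on with
  | zero => simp
  | tmul a b => simp
  | add s t hs ht => rw [tensorH_P_add, hs, ht, map_add]; abel

end Kernel

/-! ### The quadratic power operations on `B_e`. -/

section Power

variable (B : SquareGroup.{u})

theorem int_tri_add (k l : ℤ) :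
    (k + l) * (k + l - 1) / 2 = k * (k - 1) / 2 + l * (l - 1) / 2 + k * l := by
  have h : ∀ m : ℤ, 2 * (m * (m - 1) / 2) = m * (m - 1) := fun m =>
    Int.mul_ediv_cancel' (by
      rw [mul_comm]
      simpa using (Int.even_mul_succ_self (m - 1)).two_dvd)
  have h₁ := h k
  have h₂ := h l
  have h₃ := h (k + l)
  have : 2 * ((k + l) * (k + l - 1) / 2)
      = 2 * (k * (k - 1) / 2 + l * (l - 1) / 2 + k * l) := by
    rw [mul_add, mul_add, h₁, h₂, h₃]; ring
  omega

/-- The operation `y ↦ k y + (k choose 2) P H y`, a homomorphism of `B_e`; it is the action of the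
element `k` of the unit of the tensor product. -/
def pow (k : ℤ) (y : B.e) : B.e := k • y + (k * (k - 1) / 2) • B.P (B.H y)

theorem zsmul_P_comm (k : ℤ) (a : B.ee) (y : B.e) : k • B.P a + y = y + k • B.P a := by
  rw [← map_zsmul, P_central]

@[simp] theorem pow_zero (y : B.e) : B.pow 0 y = 0 := by simp [pow]

@[simp] theorem pow_one (y : B.e) : B.pow 1 y = y := by simp [pow]

/-- This is the left distributivity relation of `⊛`, with the integer `k * l` in the role of the
cross-effect. -/
theorem pow_add (k l : ℤ) (y : B.e) :
    B.pow (k + l) y = B.pow k y + B.pow l y + (k * l) • B.P (B.H y) := by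
  unfold pow
  rw [int_tri_add, add_zsmul, add_zsmul, add_zsmul]
  have := B.zsmul_P_comm (k * (k - 1) / 2) (B.H y) (l • y)
  simp only [add_assoc]
  rw [← add_assoc (_ • B.P (B.H y)) (l • y), this]
  simp only [add_assoc]

theorem cr_pow_right (k : ℤ) (x y : B.e) : B.cr x (B.pow k y) = k • B.cr x y := by
  rw [pow, cr_add_right, ← map_zsmul, cr_P_right, add_zero]
  exact map_zsmul (B.crHom x) k y

/-- Moving `y` past `pow k y'` costs `P` of `k` times `(y | y')_H`, which is precisely the cross
term in `k • P H (y + y')`. It serves as the induction step for additivity of `pow k`. -/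
theorem pow_succ_add_pow_succ (k : ℤ) (y y' : B.e) : B.pow (k + 1) y + B.pow (k + 1) y'
    = B.pow k y + B.pow k y' + (y + y' + k • B.P (B.H (y + y'))) := by
  rw [pow_add, pow_add, pow_one, pow_one, mul_one, H_add, map_add, map_add, ← map_zsmul,
    ← map_zsmul, ← map_add, ← map_add, ← map_zsmul, zsmul_add, zsmul_add, map_add, map_add]
  have h := B.add_eq_comm y (B.pow k y')
  rw [cr_pow_right] at h
  set p := B.pow k y
  set p' := B.pow k y'
  have c := fun a z => B.P_central a z
  calc p + y + B.P (k • B.H y) + (p' + y' + B.P (k • B.H y'))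
      = p + (y + p') + (y' + (B.P (k • B.H y) + B.P (k • B.H y'))) := by
        rw [add_assoc _ (B.P (k • B.H y)), c]
        simp only [add_assoc]
        rw [← map_add, ← map_add, add_comm (k • B.H y)]
    _ = p + p' + (y + (B.P (k • B.cr y y') + (y' + (B.P (k • B.H y) + B.P (k • B.H y'))))) := by
        rw [h]; simp only [add_assoc]
    _ = _ := by
        rw [c, add_assoc y', add_assoc y]

theorem pow_add_right (k : ℤ) (y y' : B.e) : B.pow k (y + y') = B.pow k y + B.pow k y' := by
  have step : ∀ l : ℤ, B.pow (l + 1) (y + y') = B.pow (l + 1) y + B.pow (l + 1) y'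
      ↔ B.pow l (y + y') = B.pow l y + B.pow l y' := fun l => by
    rw [pow_succ_add_pow_succ, pow_add B l 1 (y + y'), pow_one, mul_one, add_assoc,
      add_left_inj]
  induction k using Int.induction_on with
  | zero => simp
  | succ k h => exact (step _).2 h
  | pred k h =>
    refine (step _).1 ?_
    rwa [sub_add_cancel]

/-- Because `P H P = 2 P`, the total coefficient is `k + 2 (k choose 2) = k²`. It matches the
relation for `x ⊛ P b`, with `k²` in place of `(x | x)_H`. -/
theorem pow_P (k : ℤ) (b : B.ee) : B.pow k (B.P b) = B.P ((k * k) • b) := by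
  have h : k * k = k + 2 * (k * (k - 1) / 2) := by
    have : 2 * (k * (k - 1) / 2) = k * (k - 1) := Int.mul_ediv_cancel' (by
      rw [mul_comm]
      simpa using (Int.even_mul_succ_self (k - 1)).two_dvd)
    rw [this]; ring
  rw [pow, B.PHP, h, add_zsmul, map_add, map_zsmul, mul_comm 2, mul_zsmul, map_zsmul, map_zsmul]
  congr 2
  rw [← natCast_zsmul]; rfl

/-- The commutator of `y` with itself is trivial, and `P T = P` cancels the other two terms. It is
what the relation for `P a ⊛ y` requires of a coordinate that vanishes on `P a`. -/
theorem P_Δ (y : B.e) : B.P (B.Δ y) = 0 := by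
  rw [Δ_eq, map_add, map_sub, P_T, P_cr]; simp

theorem Hom.map_pow {B C : SquareGroup.{u}} (f : B ⟶ C) (k : ℤ) (y : B.e) :
    f.e (B.pow k y) = C.pow k (f.e y) := by
  simp only [pow, map_add, map_zsmul, f.comm_P, f.comm_H]

end Power

/-! ### Coordinates on the tensor product and joint detection of zero. -/

section Coordinate

variable {A : SquareGroup.{u}} (B : SquareGroup.{u}) (n : A.e →+ ℤ) (l : A.ee →+ ℤ)
  (hP : ∀ a, n (A.P a) = 0) (hcr : ∀ x x', l (A.cr x x') = n x * n x') (hT : ∀ a, l (A.T a) = -l a)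

/-- The homomorphism `(A ⊛ B)_e → B_e` induced by a morphism from `A` to the unit of the tensor
product. -/
def coordinate : TensorE A B →+ B.e :=
  TensorE.lift (fun x y => B.pow (n x) y) (fun a b => B.P (l a • b)) (by
    intro v w r
    cases r with
    | bar_add_left a a' b => simp [add_zsmul]
    | bar_add_right a b b' => simp only [map_add, FreeAddGroup.lift_apply_of, zsmul_add]
    | bar_central a b w => simp only [map_add, FreeAddGroup.lift_apply_of]; exact B.P_central _ _
    | circ_add_right x y₁ y₂ => simp [pow_add_right]
    | circ_add_left x₁ x₂ y => simp [pow_add, hcr, mul_comm]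
    | circ_P_right x b => simp [pow_P, hcr]
    | circ_P_left a y => simp [hP, P_Δ]
    | bar_T a b => simp [hT, P_T])

@[simp] theorem coordinate_circ (x : A.e) (y : B.e) :
    coordinate B n l hP hcr hT (circ x y) = B.pow (n x) y := by simp [coordinate]

@[simp] theorem coordinate_bar (a : A.ee) (b : B.ee) :
    coordinate B n l hP hcr hT (bar a b) = B.P (l a • b) := by simp [coordinate]

/-- Naturality is what lets an injective `f` reflect the vanishing of a coordinate. -/
theorem coordinate_map {B C : SquareGroup.{u}} (f : B ⟶ C) (u : TensorE A B) :
    f.e (coordinate B n l hP hcr hT u) = coordinate C n l hP hcr hT (tensorMapE A f u) :=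
  DFunLike.congr_fun (TensorE.hom_ext (g := f.e.comp (coordinate B n l hP hcr hT))
    (h := (coordinate C n l hP hcr hT).comp (tensorMapE A f))
    (fun x y => by simp [f.map_pow]) (fun a b => by simp [f.comm_P])) u

end Coordinate

/-- Data that describe a square group whose cokernel of `P` is free on the classes of the
elements `x i`, and whose `ee`-level splits, apart from the elements `(x i | x i)`, into two
summands exchanged by `T`. -/
structure Splitting (A : SquareGroup.{u}) (X : Type u) where
  x : X → A.e
  n : A.e →+ X →₀ ℤ
  Λ : A.ee →+ X →₀ ℤ
  S : A.ee →+ A.ee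
  n_x : ∀ i, n (x i) = Finsupp.single i 1
  n_P : ∀ a, n (A.P a) = 0
  n_ker : ∀ y, n y = 0 → y ∈ A.P.range
  Λ_cr : ∀ y y' i, Λ (A.cr y y') i = n y i * n y' i
  Λ_T : ∀ a, Λ (A.T a) = -Λ a
  decomp : ∀ a, S a + A.T (S (A.T a))
    + Finsupp.liftAddHom (fun i => (zmultiplesHom A.ee) (A.cr (x i) (x i))) (Λ a) = a

namespace Splitting

variable {A : SquareGroup.{u}} {X : Type u} (s : Splitting A X) (B : SquareGroup.{u})

/-- The coordinate of an element of `(A ⊛ B)_e` at an index. -/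
noncomputable def coord (i : X) : TensorE A B →+ B.e :=
  coordinate B ((Finsupp.applyAddHom i).comp s.n) ((Finsupp.applyAddHom i).comp s.Λ)
    (fun a => by simp [s.n_P]) (fun y y' => s.Λ_cr y y' i) (fun a => by simp [s.Λ_T])

@[simp] theorem coord_circ (i : X) (y : A.e) (z : B.e) :
    s.coord B i (circ y z) = B.pow (s.n y i) z :=
  coordinate_circ _ _ _ _ _ _ _ _

@[simp] theorem coord_bar (i : X) (a : A.ee) (b : B.ee) :
    s.coord B i (bar a b) = B.P (s.Λ a i • b) :=
  coordinate_bar _ _ _ _ _ _ _ _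

theorem coord_map {B C : SquareGroup.{u}} (f : B ⟶ C) (i : X) (u : TensorE A B) :
    f.e (s.coord B i u) = s.coord C i (tensorMapE A f u) := coordinate_map _ _ _ _ _ f u

/-- The cokernel of `P` is free. -/
noncomputable def cokerEquiv : A.CokerP ≃+ (X →₀ ℤ) :=
  AddEquiv.ofBijective (QuotientAddGroup.lift A.P.range s.n (by rintro _ ⟨a, rfl⟩; exact s.n_P a))
    ⟨(injective_iff_map_eq_zero _).2 (by
        rintro ⟨y⟩ hy
        exact (QuotientAddGroup.eq_zero_iff y).2 (s.n_ker y hy)),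
      by
        intro f
        induction f using Finsupp.induction_linear with
        | zero => exact ⟨0, map_zero _⟩
        | add f g hf hg =>
          obtain ⟨a, rfl⟩ := hf
          obtain ⟨b, rfl⟩ := hg
          exact ⟨a + b, map_add _ _ _⟩
        | single i k =>
          refine ⟨k • A.toCoker (s.x i), ?_⟩
          rw [map_zsmul]
          change k • s.n (s.x i) = _
          rw [s.n_x]; simp⟩

-- Freeness of the cokernel of `A.P` identifies `Coker P ⊗ Coker P` with a direct sum of copies of
-- `B.CokerP`. The component of `tensorπ u` at `i` is the class of `coord i u`, since the quadratic
-- correction in `pow` is a value of `P`.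
open Classical in
theorem tensorπ_eq_zero {u : TensorE A B} (h : ∀ i, s.coord B i u = 0) : tensorπ A B u = 0 := by
  let E : A.CokerP ⊗[ℤ] B.CokerP ≃ₗ[ℤ] X →₀ B.CokerP :=
    (TensorProduct.congr s.cokerEquiv.toIntLinearEquiv (LinearEquiv.refl ℤ B.CokerP)).trans
      (TensorProduct.finsuppScalarLeft ℤ B.CokerP X)
  have hE : ∀ (u : TensorE A B) i, E (tensorπ A B u) i = B.toCoker (s.coord B i u) := by
    intro u i
    induction u using TensorE.induction with
    | zero => simp
    | circ y z =>
      have : E (A.toCoker y ⊗ₜ B.toCoker z) i = s.n y i • B.toCoker z :=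
        TensorProduct.finsuppScalarLeft_apply_tmul_apply _ _ _
      rw [tensorπ_circ, this, coord_circ, pow, map_add, ← map_zsmul B.P, toCoker_P, add_zero,
        map_zsmul]
    | bar a b => simp [toCoker_P]
    | neg u h => simp [tensorπ_neg, h]
    | add u v h h' => simp [tensorπ_add, h, h']
  refine E.injective ?_
  ext i
  simp [hE, h]

-- The tensor `t` splits as `R t + R' t + I (G t)`. Invariance of `t` under `T ⊗ T` makes the first
-- two terms cancel under `P`, and the vanishing coordinates kill the third.
open Classical in
theorem tensorP_eq_zero {t : A.ee ⊗[ℤ] B.ee} (h : ∀ i, s.coord B i (tensorP A B t) = 0)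
    (hH : tensorH A B (tensorP A B t) = 0) : tensorP A B t = 0 := by
  let R : A.ee ⊗[ℤ] B.ee →ₗ[ℤ] A.ee ⊗[ℤ] B.ee := LinearMap.rTensor B.ee s.S.toIntLinearMap
  let R' : A.ee ⊗[ℤ] B.ee →ₗ[ℤ] A.ee ⊗[ℤ] B.ee :=
    LinearMap.rTensor B.ee (A.T.comp (s.S.comp A.T)).toIntLinearMap
  let TT : A.ee ⊗[ℤ] B.ee →ₗ[ℤ] A.ee ⊗[ℤ] B.ee :=
    TensorProduct.map A.T.toIntLinearMap B.T.toIntLinearMap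
  let G : A.ee ⊗[ℤ] B.ee →ₗ[ℤ] X →₀ B.ee :=
    (TensorProduct.finsuppScalarLeft ℤ B.ee X).toLinearMap.comp
      (LinearMap.rTensor B.ee s.Λ.toIntLinearMap)
  let I : (X →₀ B.ee) →+ A.ee ⊗[ℤ] B.ee := Finsupp.liftAddHom fun i =>
    (TensorProduct.mk ℤ A.ee B.ee (A.cr (s.x i) (s.x i))).toAddMonoidHom
  have hI : ∀ (f : X →₀ ℤ) (b : B.ee),
      I (TensorProduct.finsuppScalarLeft ℤ B.ee X (f ⊗ₜ b))
        = Finsupp.liftAddHom (fun i => (zmultiplesHom A.ee) (A.cr (s.x i) (s.x i))) f ⊗ₜ b := by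
    intro f b
    induction f using Finsupp.induction_linear with
    | zero => simp
    | add f g hf hg => rw [TensorProduct.add_tmul, map_add, map_add, hf, hg, map_add,
        TensorProduct.add_tmul]
    | single i k =>
      rw [TensorProduct.finsuppScalarLeft_apply_tmul]
      simp [I, TensorProduct.smul_tmul]
  have hdec : ∀ t, R t + R' t + I (G t) = t := by
    intro t
    induction t using TensorProduct.induction_on with
    | zero => simp
    | tmul a b =>
      have : I (G (a ⊗ₜ b)) = _ := hI (s.Λ a) b
      rw [this]
      change s.S a ⊗ₜ b + A.T (s.S (A.T a)) ⊗ₜ b + _ = _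
      rw [← TensorProduct.add_tmul, ← TensorProduct.add_tmul, s.decomp]
    | add t t' ht ht' =>
      conv_rhs => rw [← ht, ← ht']
      simp only [map_add]; abel
  -- As `T² = 1`, the composite `R' ∘ (T ⊗ T)` equals `(T ⊗ T) ∘ R`, and `P ∘ (T ⊗ T) = -P`.
  have hneg : ∀ t, tensorP A B (R' (TT t)) = -tensorP A B (R t) := by
    intro t
    induction t using TensorProduct.induction_on with
    | zero => simp
    | tmul a b =>
      change bar (A.T (s.S (A.T (A.T a)))) (B.T b) = -bar (s.S a) b
      rw [T_T, bar_T]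
    | add t t' ht ht' =>
      simp only [map_add, ht, ht', neg_add_rev]
      rw [← map_neg, ← map_neg, tensorP_central]
  have hG : ∀ t i, B.P (G t i) = s.coord B i (tensorP A B t) := by
    intro t i
    induction t using TensorProduct.induction_on with
    | zero => simp
    | tmul a b =>
      have : G (a ⊗ₜ b) i = s.Λ a i • b := TensorProduct.finsuppScalarLeft_apply_tmul_apply _ _ _
      rw [this, tensorP_tmul, coord_bar]
    | add t t' ht ht' => simp only [map_add, Finsupp.add_apply, ht, ht']
  have hIG : tensorP A B (I (G t)) = 0 := by
    have : I (G t) ∈ (tensorP A B).ker := by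
      rw [Finsupp.liftAddHom_apply]
      refine AddSubgroup.sum_mem _ fun i _ => ?_
      change bar (A.cr (s.x i) (s.x i)) (G t i) = 0
      -- The diagonal term is `x i ⊛ P (G t i)`, and `P (G t i)` is the coordinate of `P t` at `i`.
      rw [← circ_P_right, hG, h, circ_zero_right]
    exact this
  have ht : TT t = t := by
    rw [tensorH_tensorP, sub_eq_zero] at hH
    exact hH.symm
  have := hneg t
  rw [ht] at this
  rw [← hdec t, map_add, map_add, hIG, this, add_neg_cancel, add_zero]

/-- If a square group admits a splitting and has a flat `ee`-level, tensoring with it preserves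
injectivity. -/
theorem tensorMapE_injective (s : Splitting A X) [Module.Flat ℤ A.ee] {B C : SquareGroup.{u}} (f : B ⟶ C)
    (he : Function.Injective f.e) (hee : Function.Injective f.ee) :
    Function.Injective (tensorMapE A f) := by
  refine (injective_iff_map_eq_zero _).2 fun u hu => ?_
  have hc : ∀ i, s.coord B i u = 0 := fun i => he (by rw [coord_map, hu, map_zero, map_zero])
  have hH : tensorH A B u = 0 := by
    have hf : Function.Injective (tensorMapEE A f) :=
      -- Flatness reflects the vanishing of `H u` from `A ⊛ C` back to `A ⊛ B`.
      Module.Flat.lTensor_preserves_injective_linearMap f.ee.toIntLinearMap hee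
    refine hf ?_
    have := (tensorMap A f).comm_H u
    refine this.trans ?_
    change tensorH A C (tensorMapE A f u) = _
    rw [hu, tensorH_zero, map_zero]
  obtain ⟨t, rfl⟩ := exists_tensorP_eq A B (s.tensorπ_eq_zero B hc)
  exact s.tensorP_eq_zero B hc hH

end Splitting

end SquareGroup

namespace SquareGroup

/-! ### Functoriality in the first factor and passage to retracts. -/

section Retract

variable {A F : SquareGroup.{u}} (r : F ⟶ A) {B C : SquareGroup.{u}}

/-- The homomorphism `x ⊛ y ↦ r x ⊛ y`, `a ⊗̄ b ↦ r a ⊗̄ b`. -/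
def tensorMapLeftE (B : SquareGroup.{u}) : TensorE F B →+ TensorE A B :=
  TensorE.lift (fun x y => circ (r.e x) y) (fun a b => bar (r.ee a) b) (by
    intro v w h
    cases h with
    | bar_add_left a a' b => simp [bar_add_left]
    | bar_add_right a b b' => simp [bar_add_right]
    | bar_central a b w => simp [bar_central]
    | circ_add_right x y₁ y₂ => simp [circ_add_right]
    | circ_add_left x₁ x₂ y => simp [circ_add_left, r.map_cr]
    | circ_P_right x b => simp [circ_P_right, r.map_cr]
    | circ_P_left a y => simp [circ_P_left, r.comm_P]
    | bar_T a b => simp [bar_T, r.map_T])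

@[simp] theorem tensorMapLeftE_circ (x : F.e) (y : B.e) :
    tensorMapLeftE r B (circ x y) = circ (r.e x) y := by simp [tensorMapLeftE]
@[simp] theorem tensorMapLeftE_bar (a : F.ee) (b : B.ee) :
    tensorMapLeftE r B (bar a b) = bar (r.ee a) b := by simp [tensorMapLeftE]

theorem tensorMapE_tensorMapLeftE (f : B ⟶ C) (u : TensorE F B) :
    tensorMapE A f (tensorMapLeftE r B u) = tensorMapLeftE r C (tensorMapE F f u) :=
  DFunLike.congr_fun (TensorE.hom_ext (g := (tensorMapE A f).comp (tensorMapLeftE r B))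
    (h := (tensorMapLeftE r C).comp (tensorMapE F f)) (by simp) (by simp)) u

/-- Preservation of injectivity passes to retracts. -/
theorem tensorMapE_injective_of_retract {s : A ⟶ F} (hs : s ≫ r = 𝟙 A) {f : B ⟶ C}
    (hf : Function.Injective (tensorMapE F f)) : Function.Injective (tensorMapE A f) := by
  refine (injective_iff_map_eq_zero _).2 fun u hu => ?_
  have h : tensorMapLeftE r B (tensorMapLeftE s B u) = u :=
    DFunLike.congr_fun (TensorE.hom_ext (g := (tensorMapLeftE r B).comp (tensorMapLeftE s B))
      (h := AddMonoidHom.id _) (by simp [section_e hs]) (by simp [section_ee hs])) u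
  have h' : tensorMapLeftE s B u = 0 := hf (by
    rw [tensorMapE_tensorMapLeftE, hu, map_zero, map_zero])
  rw [← h, h', map_zero]

end Retract

/-- The homomorphism from a free abelian group with given values on the basis. -/
noncomputable def intLift {W G : Type*} [AddCommGroup G] (g : W → G) : (W →₀ ℤ) →+ G :=
  Finsupp.liftAddHom fun w => zmultiplesHom G (g w)

@[simp] theorem intLift_single {W G : Type*} [AddCommGroup G] (g : W → G) (w : W) :
    intLift g (Finsupp.single w 1) = g w := by simp [intLift]

theorem int_hom_ext {W G : Type*} [AddGroup G] {f g : (W →₀ ℤ) →+ G}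
    (h : ∀ w, f (Finsupp.single w 1) = g (Finsupp.single w 1)) : f = g := by
  refine Finsupp.addHom_ext' fun w => AddMonoidHom.ext_int ?_
  exact h w

/-! ### Free nilpotent groups of class two. -/

section Nil

/-- The relations that make the commutators of a free group central. -/
inductive NilRel (X : Type u) : FreeAddGroup X → FreeAddGroup X → Prop
  | comm (u v w : FreeAddGroup X) : NilRel X (-u - v + u + v + w) (w + (-u - v + u + v))

/-- The free nilpotent group of class two. -/
abbrev Nil (X : Type u) : Type u := (addConGen (NilRel X)).Quotient

variable {X : Type u}

/-- The generators of the free nilpotent group. -/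
def Nil.of (i : X) : Nil X := (FreeAddGroup.of i : FreeAddGroup X)

theorem Nil.comm_central (u v w : Nil X) :
    -u - v + u + v + w = w + (-u - v + u + v) := by
  induction u, v using AddCon.induction_on₂ with
  | H u v =>
    induction w using AddCon.induction_on with
    | H w => exact (AddCon.eq _).2 (AddConGen.Rel.of _ _ (.comm u v w))

@[elab_as_elim]
theorem Nil.induction {p : Nil X → Prop} (zero : p 0) (of : ∀ i, p (Nil.of i))
    (neg : ∀ u, p u → p (-u)) (add : ∀ u v, p u → p v → p (u + v)) (u : Nil X) : p u := by
  induction u using AddCon.induction_on with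
  | H w =>
    induction w using FreeAddGroup.induction_on with
    | C1 => exact zero
    | of i => exact of i
    | neg_of g h => exact neg _ h
    | add v w hv hw => exact add _ _ hv hw

theorem Nil.hom_ext {G : Type*} [AddGroup G] {f g : Nil X →+ G}
    (h : ∀ i, f (Nil.of i) = g (Nil.of i)) : f = g := by
  refine DFunLike.ext _ _ fun u => ?_
  induction u using Nil.induction with
  | zero => simp
  | of i => exact h i
  | neg u hu => simp [hu]
  | add u v hu hv => simp [hu, hv]

/-- The universal property of the free nilpotent group. -/
def Nil.lift {G : Type*} [AddGroup G] (f : X → G)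
    (h : ∀ u v w : G, -u - v + u + v + w = w + (-u - v + u + v)) : Nil X →+ G :=
  AddCon.lift _ (FreeAddGroup.lift f)
    (AddCon.addConGen_le.2 fun v w r => (AddCon.ker_rel _).2 (by
      cases r with
      | comm u v w => simpa using h _ _ _))

@[simp] theorem Nil.lift_of {G : Type*} [AddGroup G] (f : X → G) (h) (i : X) :
    Nil.lift f h (Nil.of i) = f i := by
  unfold Nil.lift Nil.of
  rw [AddCon.lift_coe, FreeAddGroup.lift_apply_of]

end Nil

/-! ### Free square groups and their splitting. -/

section Free

variable (X Y : Type u)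

/-- The basis of the `ee`-level of the free square group: the elements `(i | j)`, the generators
`z` (among which the `H i`) and their images under `T`. -/
inductive FreeIndex : Type u
  | cross (i j : X)
  | plus (z : X ⊕ Y)
  | minus (z : X ⊕ Y)

/-- The `ee`-level of the free square group. -/
abbrev FreeEE : Type u := FreeIndex X Y →₀ ℤ

variable {X Y}

/-- The basis elements of the `ee`-level of the free square group. -/
noncomputable abbrev fe (w : FreeIndex X Y) : FreeEE X Y := Finsupp.single w 1

variable (X Y)

/-- The cross-effect of the free square group as a biadditive map. -/
noncomputable def freeCrHom : (X →₀ ℤ) →+ (X →₀ ℤ) →+ FreeEE X Y :=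
  intLift fun i => intLift fun j => fe (.cross i j)

/-- The cross-effect of the free square group. -/
noncomputable def freeCr : (X →₀ ℤ) →ₗ[ℤ] (X →₀ ℤ) →ₗ[ℤ] FreeEE X Y :=
  LinearMap.mk₂ ℤ (fun c d => freeCrHom X Y c d)
    (fun c c' d => by rw [map_add, AddMonoidHom.add_apply])
    (fun n c d => by rw [map_zsmul, AddMonoidHom.zsmul_apply])
    (fun c d d' => by rw [map_add])
    (fun n c d => by rw [map_zsmul])

@[simp] theorem freeCr_single (i j : X) :
    freeCr X Y (Finsupp.single i 1) (Finsupp.single j 1) = fe (.cross i j) := by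
  change freeCrHom X Y _ _ = _
  simp [freeCrHom]

/-- The homomorphism whose components are the abelianization and the quadratic map `H`. -/
noncomputable def freeTwist : Nil X →+ Twist (freeCr X Y) :=
  -- A commutator in the twisted group has base component zero, so it is central and the universal
  -- property of `Nil` applies.
  Nil.lift (fun i => ⟨Finsupp.single i 1, fe (.plus (.inl i))⟩) (fun u v w => by
    ext1
    · simp [sub_eq_add_neg]
    · simp [sub_eq_add_neg]; abel)

/-- The abelianization. -/
noncomputable def freeAb : Nil X →+ X →₀ ℤ :=
  AddMonoidHom.mk' (fun u => (freeTwist X Y u).base) (fun u v => by simp)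

@[simp] theorem freeAb_of (i : X) : freeAb X Y (Nil.of i) = Finsupp.single i 1 := by
  simp [freeAb, freeTwist]

/-- The quadratic map `H` on the nilpotent part. -/
noncomputable def freeH (u : Nil X) : FreeEE X Y := (freeTwist X Y u).val

theorem freeH_add (u v : Nil X) : freeH X Y (u + v)
    = freeH X Y u + freeH X Y v + freeCr X Y (freeAb X Y u) (freeAb X Y v) := by
  simp [freeH, freeAb]

theorem freeH_neg (u : Nil X) : freeH X Y (-u)
    = -freeH X Y u + freeCr X Y (freeAb X Y u) (freeAb X Y u) := by
  simp [freeH, freeAb]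

@[simp] theorem freeH_zero : freeH X Y 0 = 0 := by simp [freeH]

@[simp] theorem freeH_of (i : X) : freeH X Y (Nil.of i) = fe (.plus (.inl i)) := by
  simp [freeH, freeTwist]

attribute [local instance] centerAddCommGroup

/-- The homomorphism `P` of the free square group, first component. -/
noncomputable def freePNil : FreeEE X Y →+ Nil X :=
  (AddSubgroup.center (Nil X)).subtype.comp (intLift fun w => match w with
    | .cross i j => ⟨-Nil.of i - Nil.of j + Nil.of i + Nil.of j,
        AddSubgroup.mem_center_iff.2 fun g => (Nil.comm_central _ _ g).symm⟩
    | .plus _ => 0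
    | .minus _ => 0)

theorem freePNil_central (a : FreeEE X Y) (g : Nil X) :
    freePNil X Y a + g = g + freePNil X Y a :=
  (AddSubgroup.mem_center_iff.1 (Subtype.prop (p := (· ∈ AddSubgroup.center (Nil X))) _) g).symm

@[simp] theorem freePNil_cross (i j : X) : freePNil X Y (fe (.cross i j))
    = -Nil.of i - Nil.of j + Nil.of i + Nil.of j := by simp [freePNil]
@[simp] theorem freePNil_plus (z : X ⊕ Y) : freePNil X Y (fe (.plus z)) = 0 := by
  simp [freePNil]
@[simp] theorem freePNil_minus (z : X ⊕ Y) : freePNil X Y (fe (.minus z)) = 0 := by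
  simp [freePNil]

/-- The homomorphism `P` of the free square group, second component. -/
noncomputable def freePAb : FreeEE X Y →+ (X ⊕ Y →₀ ℤ) :=
  intLift fun w => match w with
    | .cross _ _ => 0
    | .plus z => Finsupp.single z 1
    | .minus z => Finsupp.single z 1

@[simp] theorem freePAb_cross (i j : X) : freePAb X Y (fe (.cross i j)) = 0 := by simp [freePAb]
@[simp] theorem freePAb_plus (z : X ⊕ Y) : freePAb X Y (fe (.plus z)) = Finsupp.single z 1 := by
  simp [freePAb]
@[simp] theorem freePAb_minus (z : X ⊕ Y) :
    freePAb X Y (fe (.minus z)) = Finsupp.single z 1 := by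
  simp [freePAb]

/-- The involution `T` of the free square group. -/
noncomputable def freeT : FreeEE X Y →+ FreeEE X Y :=
  intLift fun w => match w with
    | .cross i j => -fe (.cross j i)
    | .plus z => fe (.minus z)
    | .minus z => fe (.plus z)

@[simp] theorem freeT_cross (i j : X) : freeT X Y (fe (.cross i j)) = -fe (.cross j i) := by
  simp [freeT]
@[simp] theorem freeT_plus (z : X ⊕ Y) : freeT X Y (fe (.plus z)) = fe (.minus z) := by
  simp [freeT]
@[simp] theorem freeT_minus (z : X ⊕ Y) : freeT X Y (fe (.minus z)) = fe (.plus z) := by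
  simp [freeT]

/-- The quadratic map `H` on the abelian part. -/
noncomputable def freeHAb : (X ⊕ Y →₀ ℤ) →+ FreeEE X Y :=
  intLift fun z => fe (.plus z) + fe (.minus z)

@[simp] theorem freeHAb_single (z : X ⊕ Y) :
    freeHAb X Y (Finsupp.single z 1) = fe (.plus z) + fe (.minus z) := by simp [freeHAb]

@[simp] theorem freeAb_freePNil (a : FreeEE X Y) : freeAb X Y (freePNil X Y a) = 0 := by
  refine DFunLike.congr_fun (f := (freeAb X Y).comp (freePNil X Y)) (g := 0) (int_hom_ext ?_) a
  rintro (⟨i, j⟩ | z | z)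
  · simp [sub_eq_add_neg]
  · simp
  · simp

/-- On generators the correction is the commutator by which `freePNil` is defined on `cross i j`.
Centrality of the values of `freePNil` carries the identity over to sums and negatives in either
variable. -/
theorem free_comm (u v : Nil X) : u + v
    = v + u + freePNil X Y (freeCr X Y (freeAb X Y u) (freeAb X Y v)) := by
  have c := freePNil_central X Y
  induction u using Nil.induction with
  | zero => simp
  | neg u h =>
    rw [map_neg, map_neg, LinearMap.neg_apply, map_neg]
    set t := freeCr X Y (freeAb X Y u) (freeAb X Y v)
    apply add_left_cancel (a := u)
    rw [add_neg_cancel_left, ← add_assoc, ← add_assoc, h, add_assoc (v + u), c]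
    simp [add_assoc]
  | add u u' h h' =>
    rw [map_add, map_add, LinearMap.add_apply, map_add]
    rw [add_assoc, h', ← add_assoc, ← add_assoc, h]
    rw [add_assoc (v + u), c]
    simp [add_assoc]
  | of i =>
    induction v using Nil.induction with
    | zero => simp
    | of j => simp [sub_eq_add_neg, add_assoc]
    | neg v h =>
      rw [map_neg, map_neg, map_neg]
      set t := freeCr X Y (freeAb X Y (Nil.of i)) (freeAb X Y v)
      apply add_left_cancel (a := v)
      rw [← add_assoc, ← add_assoc, ← add_assoc, add_neg_cancel, zero_add]
      have h' : v + Nil.of i = Nil.of i + v - freePNil X Y t := by rw [h]; simp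
      rw [h', sub_eq_add_neg, ← map_neg, add_assoc _ v, ← c]
      simp only [add_assoc]
      rw [c]
      simp
    | add v v' h h' =>
      rw [map_add, map_add, map_add]
      rw [← add_assoc, h, add_assoc _ _ v', c, ← add_assoc, add_assoc v, h']
      rw [c (freeCr X Y _ (freeAb X Y v))]
      simp only [add_assoc]

/-- Values of `freePNil` vanish in the abelianization, so the left side is additive in `a` and a
check on the basis suffices. The identity says that `freeT` is the involution `HP - Id`. -/
theorem freeH_freeP (a : FreeEE X Y) :
    freeH X Y (freePNil X Y a) + freeHAb X Y (freePAb X Y a) = a + freeT X Y a := by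
  let φ : FreeEE X Y →+ FreeEE X Y :=
    AddMonoidHom.mk' (fun a => freeH X Y (freePNil X Y a) + freeHAb X Y (freePAb X Y a))
      (fun a b => by simp only [map_add, freeH_add, freeAb_freePNil, map_zero]; abel)
  refine DFunLike.congr_fun (f := φ) (g := AddMonoidHom.id _ + freeT X Y) (int_hom_ext ?_) a
  rintro (⟨i, j⟩ | z | z)
  · change freeH X Y (freePNil X Y (fe (.cross i j))) + freeHAb X Y (freePAb X Y (fe (.cross i j)))
      = fe (.cross i j) + freeT X Y (fe (.cross i j))
    simp [freeH_add, freeH_neg, sub_eq_add_neg]; abel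
  · change freeH X Y (freePNil X Y (fe (.plus z))) + freeHAb X Y (freePAb X Y (fe (.plus z)))
      = fe (.plus z) + freeT X Y (fe (.plus z))
    simp
  · change freeH X Y (freePNil X Y (fe (.minus z))) + freeHAb X Y (freePAb X Y (fe (.minus z)))
      = fe (.minus z) + freeT X Y (fe (.minus z))
    simp [add_comm]

/-- Exchanging the entries of a commutator inverts it, which offsets the sign in `freeT`. Together
with `freePAb_freeT` this yields `P H P = 2 P`. -/
theorem freePNil_freeT (a : FreeEE X Y) : freePNil X Y (freeT X Y a) = freePNil X Y a := by
  refine DFunLike.congr_fun (f := (freePNil X Y).comp (freeT X Y)) (int_hom_ext ?_) a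
  rintro (⟨i, j⟩ | z | z)
  · simp [sub_eq_add_neg, add_assoc]
  · simp
  · simp

theorem freePAb_freeT (a : FreeEE X Y) : freePAb X Y (freeT X Y a) = freePAb X Y a := by
  refine DFunLike.congr_fun (f := (freePAb X Y).comp (freeT X Y)) (int_hom_ext ?_) a
  rintro (⟨i, j⟩ | z | z)
  · simp
  · simp
  · simp

theorem crossEffect_free (u v : Nil X × (X ⊕ Y →₀ ℤ)) :
    crossEffect (fun u : Nil X × (X ⊕ Y →₀ ℤ) => freeH X Y u.1 + freeHAb X Y u.2) u v
      = freeCr X Y (freeAb X Y u.1) (freeAb X Y v.1) := by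
  simp only [crossEffect, Prod.fst_add, Prod.snd_add, freeH_add, map_add]; abel

/-- The free square group on a set `X` of generators of the `e`-level and a set `Y` of generators
of the `ee`-level. -/
noncomputable def free : SquareGroup.{u} where
  e := Nil X × (X ⊕ Y →₀ ℤ)
  ee := FreeEE X Y
  P := (freePNil X Y).prod (freePAb X Y)
  H u := freeH X Y u.1 + freeHAb X Y u.2
  quadratic :=
    ⟨fun u u' v => by simp [crossEffect_free], fun u v v' => by simp [crossEffect_free]⟩
  cross_P_left a v := by simp [crossEffect_free]
  cross_P_right u a := by simp [crossEffect_free]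
  P_cross u v := by
    have h : ∀ i j, freePAb X Y (freeCr X Y i j) = 0 := fun i j => by
      change ((AddMonoidHom.compHom (freePAb X Y)).comp (freeCrHom X Y)) i j = 0
      have : (AddMonoidHom.compHom (freePAb X Y)).comp (freeCrHom X Y) = 0 :=
        int_hom_ext fun i => int_hom_ext fun j => by simp [freeCrHom]
      rw [this]; rfl
    rw [crossEffect_free]
    refine Prod.ext ?_ ?_
    · change freePNil X Y _ = -u.1 - v.1 + u.1 + v.1
      rw [add_assoc, free_comm X Y u.1 v.1]
      simp [sub_eq_add_neg, add_assoc]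
    · change freePAb X Y _ = -u.2 - v.2 + u.2 + v.2
      rw [h]; abel
  PHP a := by
    change (freePNil X Y (freeH X Y (freePNil X Y a) + freeHAb X Y (freePAb X Y a)),
      freePAb X Y (freeH X Y (freePNil X Y a) + freeHAb X Y (freePAb X Y a))) = _
    rw [freeH_freeP, map_add, map_add, freePNil_freeT, freePAb_freeT, two_nsmul]
    rfl

theorem free_cr (u v : (free X Y).e) :
    (free X Y).cr u v = freeCr X Y (freeAb X Y u.1) (freeAb X Y v.1) := crossEffect_free X Y u v

/-- The generators of the `e`-level of the free square group. -/
noncomputable def freeX (i : X) : (free X Y).e := ((Nil.of i, 0) : Nil X × (X ⊕ Y →₀ ℤ))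

theorem free_cr_freeX (i j : X) :
    (free X Y).cr (freeX X Y i) (freeX X Y j) = fe (.cross i j) := by
  refine (free_cr X Y _ _).trans ?_
  change freeCr X Y (freeAb X Y (Nil.of i)) (freeAb X Y (Nil.of j)) = _
  rw [freeAb_of, freeAb_of]
  exact freeCr_single X Y i j

theorem free_T (a : (free X Y).ee) : (free X Y).T a = freeT X Y a := by
  rw [T_apply]
  exact sub_eq_of_eq_add' (freeH_freeP X Y a)

instance : Module.Flat ℤ (free X Y).ee :=
  inferInstanceAs (Module.Flat ℤ (FreeIndex X Y →₀ ℤ))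

open Classical in
/-- One half of the antidiagonal part of the `ee`-level of the free square group. -/
noncomputable def freeS : FreeEE X Y →+ FreeEE X Y :=
  intLift fun w => match w with
    | .cross i j => if WellOrderingRel i j then fe (.cross i j) else 0
    | .plus z => fe (.plus z)
    | .minus _ => 0

open Classical in
/-- The coefficients at the elements `(i | i)`. -/
noncomputable def freeDiag : FreeEE X Y →+ X →₀ ℤ :=
  intLift fun w => match w with
    | .cross i j => if i = j then Finsupp.single i 1 else 0
    | .plus _ => 0
    | .minus _ => 0

/-- The first component of the `e`-level, abelianized. -/
noncomputable def freeN : (free X Y).e →+ X →₀ ℤ :=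
  (freeAb X Y).comp (AddMonoidHom.fst (Nil X) (X ⊕ Y →₀ ℤ))

/-- Modulo `P` the abelian component of `u` disappears, being `P` of a combination of the elements
`plus z`. The class of the nilpotent component depends only on its abelianization, because the
cokernel is abelian. -/
theorem freeN_ker (u : (free X Y).e) (h : freeN X Y u = 0) : u ∈ (free X Y).P.range := by
  let ψ : (X →₀ ℤ) →+ (free X Y).CokerP := intLift fun i => (free X Y).toCoker (Nil.of i, 0)
  let inl : Nil X →+ (free X Y).e := AddMonoidHom.inl (Nil X) (X ⊕ Y →₀ ℤ)
  have hψ : ψ.comp (freeAb X Y) = (free X Y).toCoker.comp inl :=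
    Nil.hom_ext fun i => by
      rw [AddMonoidHom.comp_apply, freeAb_of]
      exact intLift_single _ _
  have hu : (free X Y).toCoker u = 0 := by
    have h₂ : (free X Y).P (intLift (fun z => fe (.plus z)) u.2) = ((0, u.2) : Nil X × _) := by
      refine Prod.ext ?_ ?_
      · refine DFunLike.congr_fun (f := (freePNil X Y).comp (intLift (fun z => fe (.plus z))))
          (g := 0) (int_hom_ext fun z => ?_) u.2
        simp
      · refine DFunLike.congr_fun (f := (freePAb X Y).comp (intLift (fun z => fe (.plus z))))
          (g := AddMonoidHom.id _) (int_hom_ext fun z => ?_) u.2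
        simp
    obtain ⟨a, h₁⟩ : ∃ a : (free X Y).ee, u = inl u.1 + (free X Y).P a :=
      ⟨_, (Prod.ext (add_zero _).symm (zero_add _).symm :
          (u : Nil X × (X ⊕ Y →₀ ℤ)) = (u.1, 0) + (0, u.2)).trans
        (congrArg (inl u.1 + · : (free X Y).e → (free X Y).e) h₂.symm)⟩
    have h₃ : (free X Y).toCoker u = (free X Y).toCoker (inl u.1) := by
      refine (congrArg (free X Y).toCoker h₁).trans ?_
      rw [map_add, toCoker_P, add_zero]
    have h₄ : freeAb X Y u.1 = 0 := h
    rw [h₃]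
    refine (DFunLike.congr_fun hψ u.1).symm.trans ?_
    rw [AddMonoidHom.comp_apply, h₄, map_zero]
  exact (QuotientAddGroup.eq_zero_iff u).1 hu

theorem freeDiag_freeCr (c d : X →₀ ℤ) (i : X) :
    freeDiag X Y (freeCr X Y c d) i = c i * d i := by
  classical
  change ((AddMonoidHom.compHom ((Finsupp.applyAddHom i).comp (freeDiag X Y))).comp
    (freeCrHom X Y)) c d = ((AddMonoidHom.mul).comp (Finsupp.applyAddHom i)) c
      (Finsupp.applyAddHom i d)
  change _ = ((AddMonoidHom.compHom' (Finsupp.applyAddHom i)).comp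
    ((AddMonoidHom.mul).comp (Finsupp.applyAddHom i))) c d
  congr 1
  refine DFunLike.congr_fun (int_hom_ext fun j => int_hom_ext fun k => ?_) c
  by_cases h : j = k
  · subst h
    by_cases h' : j = i <;> simp [freeCrHom, freeDiag, h']
  · by_cases h' : j = i
    · subst h'
      simp [freeCrHom, freeDiag, h]
    · simp [freeCrHom, freeDiag, Finsupp.single_apply, h, h']

/-- The free square group has a splitting. -/
noncomputable def freeSplitting : Splitting (free X Y) X where
  x := freeX X Y
  n := freeN X Y
  Λ := freeDiag X Y
  S := freeS X Y
  n_x i := freeAb_of X Y i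
  n_P a := freeAb_freePNil X Y a
  n_ker := freeN_ker X Y
  Λ_cr u v i := by rw [free_cr]; exact freeDiag_freeCr X Y _ _ i
  Λ_T a := by
    rw [free_T]
    refine DFunLike.congr_fun (f := (freeDiag X Y).comp (freeT X Y)) (g := -freeDiag X Y)
      (int_hom_ext ?_) a
    rintro (⟨i, j⟩ | z | z)
    · by_cases h : i = j
      · subst h; simp [freeDiag]
      · simp [freeDiag, h, Ne.symm h]
    · simp [freeDiag]
    · simp [freeDiag]
  decomp a := by
    simp only [free_cr_freeX, free_T]
    refine DFunLike.congr_fun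
      (f := freeS X Y + (freeT X Y).comp ((freeS X Y).comp (freeT X Y))
        + (intLift (G := FreeEE X Y)
          fun i => fe (.cross i i)).comp (freeDiag X Y))
      (g := AddMonoidHom.id _) (int_hom_ext ?_) a
    rintro (⟨i, j⟩ | z | z)
    -- As `T` exchanges `(i | j)` with `-(j | i)`, a linear order on `X` selects one half of the
    -- off-diagonal elements for `S`, and `T S T` recovers the other. On the diagonal `T` acts as
    -- `-1`, and `freeDiag` supplies those elements.
    · rcases trichotomous_of WellOrderingRel i j with h | h | h
      · have h₁ : ¬WellOrderingRel j i := asymm h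
        have h₂ : i ≠ j := fun e => irrefl i (e ▸ h : WellOrderingRel i i)
        simp [freeS, freeDiag, h, h₁, h₂]
      · subst h
        have h₁ : ¬WellOrderingRel i i := irrefl i
        simp [freeS, freeDiag, h₁]
      · have h₁ : ¬WellOrderingRel i j := asymm h
        have h₂ : i ≠ j := fun e => irrefl i (e ▸ h : WellOrderingRel i i)
        simp [freeS, freeDiag, h, h₁, h₂]
    · simp [freeS, freeDiag]
    · simp [freeS, freeDiag]

end Free

end SquareGroup

namespace SquareGroup

/-! ### Free covers and projective square groups. -/

section Cover

variable (A : SquareGroup.{u})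

theorem comm_central (u v w : A.e) : -u - v + u + v + w = w + (-u - v + u + v) := by
  rw [← P_cr, P_central]

/-- The values of the canonical morphism from the free square group on the generators of the
`ee`-level. -/
def coverGen (z : A.e ⊕ A.ee) : A.ee := z.elim A.H id

/-- The canonical homomorphism from the free nilpotent group. -/
def coverNil : Nil A.e →+ A.e := Nil.lift id A.comm_central

@[simp] theorem coverNil_of (x : A.e) : A.coverNil (Nil.of x) = x := by simp [coverNil]

/-- The canonical morphism from the free square group, on the `ee`-level. -/
noncomputable def coverEE : FreeEE A.e A.ee →+ A.ee :=
  intLift fun w => match w with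
    | .cross x y => A.cr x y
    | .plus z => A.coverGen z
    | .minus z => A.T (A.coverGen z)

@[simp] theorem coverEE_cross (x y : A.e) : A.coverEE (fe (.cross x y)) = A.cr x y := by
  simp [coverEE]
@[simp] theorem coverEE_plus (z : A.e ⊕ A.ee) : A.coverEE (fe (.plus z)) = A.coverGen z := by
  simp [coverEE]
@[simp] theorem coverEE_minus (z : A.e ⊕ A.ee) :
    A.coverEE (fe (.minus z)) = A.T (A.coverGen z) := by
  simp [coverEE]

/-- The canonical morphism from the free square group, on the `e`-level. -/
noncomputable def coverE : Nil A.e × (A.e ⊕ A.ee →₀ ℤ) →+ A.e :=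
  AddMonoidHom.mk' (fun u => A.coverNil u.1 + A.P (intLift A.coverGen u.2)) (fun u v => by
    simp only [Prod.fst_add, Prod.snd_add, map_add]
    have h := A.P_central (intLift A.coverGen u.2) (A.coverNil v.1)
    simp only [add_assoc]
    rw [← add_assoc (A.P (intLift A.coverGen u.2)) (A.coverNil v.1), h, add_assoc])

theorem coverE_apply (u : Nil A.e × (A.e ⊕ A.ee →₀ ℤ)) :
    A.coverE u = A.coverNil u.1 + A.P (intLift A.coverGen u.2) := rfl

/-- Both sides are biadditive in `u` and `v` and agree on generators by the choice of `coverEE` on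
`cross x y`. -/
theorem coverEE_freeCr (u v : Nil A.e) : A.coverEE (freeCr A.e A.ee (freeAb A.e A.ee u)
    (freeAb A.e A.ee v)) = A.cr (A.coverNil u) (A.coverNil v) := by
  have hn : ∀ x y, A.cr (-x) y = -A.cr x y := fun x y => by
    rw [← crHom_apply, map_neg]; rfl
  induction u using Nil.induction with
  | zero => simp
  | neg u h => simp [h, hn]
  | add u u' h h' => simp [h, h', cr_add_left]
  | of x =>
    induction v using Nil.induction with
    | zero => simp
    | neg u h => simp only [map_neg, h, cr_neg_right]
    | add u u' h h' => simp only [map_add, h, h', cr_add_right]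
    | of y => simp

theorem H_neg (x : A.e) : A.H (-x) = -A.H x + A.cr x x := by
  have h := A.H_add x (-x)
  rw [add_neg_cancel, H_zero, cr_neg_right] at h
  rw [← sub_eq_zero, h]; abel

/-- Both sides follow the same rule for sums and negatives, their cross-effects agreeing by
`coverEE_freeCr`; on a generator `x` both equal `A.H x`. -/
theorem coverEE_freeH (u : Nil A.e) :
    A.coverEE (freeH A.e A.ee u) = A.H (A.coverNil u) := by
  induction u using Nil.induction with
  | zero => simp [H_zero]
  | of x => simp [coverGen]
  | neg u h => rw [freeH_neg, map_add, map_neg, h, coverEE_freeCr, map_neg, H_neg]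
  | add u v h h' => rw [freeH_add, map_add, map_add, h, h', coverEE_freeCr, map_add, H_add]

/-- The canonical morphism from a free square group. -/
noncomputable def cover : free A.e A.ee ⟶ A where
  e := A.coverE
  ee := A.coverEE
  comm_P a := by
    refine DFunLike.congr_fun (f := A.coverE.comp ((freePNil A.e A.ee).prod (freePAb A.e A.ee)))
      (g := A.P.comp A.coverEE) (int_hom_ext ?_) a
    rintro (⟨i, j⟩ | z | z)
    · simp [coverE_apply, P_cr]
    · simp [coverE_apply]
    · simp [coverE_apply, P_T]
  comm_H u := by
    change A.coverEE (freeH A.e A.ee u.1 + freeHAb A.e A.ee u.2) = A.H (A.coverE u)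
    have h : ∀ d, A.coverEE (freeHAb A.e A.ee d) = A.H (A.P (intLift A.coverGen d)) := fun d => by
      let φ : A.ee →+ A.ee := AddMonoidHom.mk' (fun a => A.H (A.P a)) A.H_P_add
      refine DFunLike.congr_fun (f := A.coverEE.comp (freeHAb A.e A.ee))
        (g := φ.comp (intLift A.coverGen)) (int_hom_ext fun z => ?_) d
      simp [φ, T_apply]
    rw [map_add, coverEE_freeH, h]
    exact ((A.H_add _ _).trans (by rw [cr_P_right, add_zero])).symm

theorem cover_surjective_e : Function.Surjective A.cover.e := fun x =>
  ⟨freeX A.e A.ee x, by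
    change A.coverE (Nil.of x, 0) = x
    simp [coverE_apply]⟩

theorem cover_surjective_ee : Function.Surjective A.cover.ee := fun a =>
  ⟨fe (.plus (.inr a)), by
    change A.coverEE (fe (.plus (.inr a))) = a
    simp [coverGen]⟩

/-- Projectivity is lifting against categorical epimorphisms, so the levelwise surjective `cover`
must be recognized as one. -/
theorem epi_of_surjective {B C : SquareGroup.{u}} (f : B ⟶ C) (he : Function.Surjective f.e)
    (hee : Function.Surjective f.ee) : Epi f where
  left_cancellation g h w := by
    ext x
    · obtain ⟨x, rfl⟩ := he x
      exact DFunLike.congr_fun (congrArg Hom.e w) x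
    · obtain ⟨x, rfl⟩ := hee x
      exact DFunLike.congr_fun (congrArg Hom.ee w) x

theorem mono_of_injective {B C : SquareGroup.{u}} (f : B ⟶ C) (he : Function.Injective f.e)
    (hee : Function.Injective f.ee) : Mono f where
  right_cancellation g h w := by
    ext x
    · exact he (DFunLike.congr_fun (congrArg Hom.e w) x)
    · exact hee (DFunLike.congr_fun (congrArg Hom.ee w) x)

/-- Tensoring with a projective square group preserves levelwise injective morphisms. -/
theorem mono_tensorLeft_map [Projective A] {B C : SquareGroup.{u}} (f : B ⟶ C)
    (he : Function.Injective f.e) (hee : Function.Injective f.ee) :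
    Mono ((tensorLeft A).map f) := by
  have : Epi A.cover := epi_of_surjective _ A.cover_surjective_e A.cover_surjective_ee
  let s := Projective.factorThru (𝟙 A) A.cover
  have hs : s ≫ A.cover = 𝟙 A := Projective.factorThru_comp _ _
  -- The section of `cover` makes `A.ee` a direct summand of a free abelian group.
  have : Module.Flat ℤ A.ee := Module.Flat.of_retract (M := (free A.e A.ee).ee)
    s.ee.toIntLinearMap A.cover.ee.toIntLinearMap
    (LinearMap.ext fun a => section_ee hs a)
  exact mono_of_injective _
    (tensorMapE_injective_of_retract A.cover hs
      ((freeSplitting A.e A.ee).tensorMapE_injective f he hee))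
    (Module.Flat.lTensor_preserves_injective_linearMap f.ee.toIntLinearMap hee)

end Cover

end SquareGroup

theorem mainTheorem2 (A : SquareGroup.{u}) :
    PreservesFilteredColimits (SquareGroup.tensorLeft A) ∧
    (∀ {B C : SquareGroup.{u}} (f g : B ⟶ C) [IsReflexivePair f g],
      PreservesColimit (parallelPair f g) (SquareGroup.tensorLeft A)) ∧
    PreservesFiniteProducts (SquareGroup.tensorLeft A) ∧
    (∀ {B₁ B B₂ : SquareGroup.{u}} (μ : B₁ ⟶ B) (σ : B ⟶ B₂), SquareGroup.ShortExact μ σ →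
      SquareGroup.RightExact ((SquareGroup.tensorLeft A).map μ)
        ((SquareGroup.tensorLeft A).map σ)) ∧
    (Projective A →
      ∀ {B₁ B B₂ : SquareGroup.{u}} (μ : B₁ ⟶ B) (σ : B ⟶ B₂), SquareGroup.ShortExact μ σ →
        Mono ((SquareGroup.tensorLeft A).map μ)) :=
  ⟨SquareGroup.preservesFilteredColimits_tensorLeft A,
    fun f g _ => SquareGroup.preservesColimit_parallelPair A f g,
    SquareGroup.preservesFiniteProducts_tensorLeft A, fun _ _ h => h.rightExact.tensorLeft_map A,
    fun _ _ _ _ μ _ h => A.mono_tensorLeft_map μ h.injective_e h.injective_ee⟩
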